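/- Let $A\in\mathbb R^{n\times n}$, $B_u\in\mathbb R^{n\times m}$, $B_d\in\mathbb R^{n\times p}$, $C\in\mathbb R^{p\times n}$, $D\in\mathbb R^{p\times p}$. For $K\in\mathbb R^{m\times n}$ put $A_K:=A-B_uK$. The system $\dot x=Ax+B_uu+B_dd$, $y=Cx+Dd$ under the state feedback $u=-Kx$ becomes the closed loop $$\dot x=A_Kx+B_dd,\qquad y=Cx+Dd .$$ The closed loop is called strictly passive with storage function $S$ if $S:\mathbb R^n\to\mathbb R$ is continuously differentiable and positive semidefinite ($S(0)=0$, $S\ge 0$) and there is a positive definite function $\psi:\mathbb R^n\to\mathbb R$ ($\psi(0)=0$, $\psi(x)>0$ for $x\ne0$) such that $$\nabla S(x)^\top(A_Kx+B_dd)\le d^\top(Cx+Dd)-\psi(x)\qquad\text{for all }x\in\mathbb R^n,\ d\in\mathbb R^p;$$ it is called passive with storage function $S$ if the same holds with $\psi\equiv0$. It is (strictly) passive if it is so with some storage function. Write $X\preceq_s0$ for $X\prec0$ when strict passivity is considered, and for $X\preceq0$ when passivity is considered. For $Z\in\mathbb R^{n\times n}$ and $W\in\mathbb R^{m\times n}$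 let $$N_0(Z,W)=ZA^\top+AZ-W^\top B_u^\top-B_uW,\qquad N_D(Z,W)=\begin{bmatrix}N_0(Z,W)&B_d-ZC^\top\\ B_d^\top-CZ&-D-D^\top\end{bmatrix},$$ and consider the condition $$(\ast)\qquad N_D(Z,W)\preceq_s0\ \text{ if }D\neq0;\qquad N_0(Z,W)\preceq_s0\ \text{ and }\ B_d^\top=CZ\ \text{ if }D=0 .$$ Proposition. The following holds for passivity and for strict passivity. (1) Let $K\in\mathbb R^{m\times n}$ be such that $(A_K,B_d)$ is controllable and $(A_K,C)$ is observable; in the strict case with $D\ne0$ assume also that $D+D^\top$ is nonsingular. Then the closed loop under $u=-Kx$ is (strictly) passive if and only if there exist $Z\succ0$ and $W\in\mathbb R^{m\times n}$ satisfying $(\ast)$ with $K=WZ^{-1}$. (2) Whenever $Z\succ0$ and $W\in\mathbb R^{m\times n}$ satisfy $(\ast)$, the closed loop under $u=-Kx$ with $K=WZ^{-1}$ is (strictly) passive with storage function $S(x)=\tfrac12x^\top Z^{-1}x$. -/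

import Mathlib

open scoped Matrix

noncomputable section

/-- Selects one of the two versions of the result: passivity or strict passivity. -/
inductive PassivityMode where
  | nonstrict
  | strict

/-- The relation `X ⪯ₛ 0`: `X ≺ 0` in the strict version, `X ⪯ 0` in the nonstrict version.
(`Matrix.PosDef` and `Matrix.PosSemidef` include symmetry.) -/
def NegS {ι : Type*} [Fintype ι] (mode : PassivityMode) (X : Matrix ι ι ℝ) : Prop :=
  match mode with
  | .nonstrict => (-X).PosSemidef
  | .strict => (-X).PosDef

/-- A function on the state space that vanishes at the origin and is nonnegative. -/
def IsPosSemidefFun {n : ℕ} (S : (Fin n → ℝ) → ℝ) : Prop :=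
  S 0 = 0 ∧ ∀ x, 0 ≤ S x

/-- A function on the state space that vanishes at the origin and is positive elsewhere. -/
def IsPosDefFun {n : ℕ} (ψ : (Fin n → ℝ) → ℝ) : Prop :=
  ψ 0 = 0 ∧ ∀ x, x ≠ 0 → 0 < ψ x

/-- The dissipation rate admitted in each version: positive definite in the strict version,
identically zero in the nonstrict version. -/
def IsDissipationRate {n : ℕ} (mode : PassivityMode) (ψ : (Fin n → ℝ) → ℝ) : Prop :=
  match mode with
  | .nonstrict => ∀ x, ψ x = 0
  | .strict => IsPosDefFun ψ

/-- `S` is a storage function certifying (strict) passivity of the system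
`x' = A x + B v`, `z = C x + D v`: it is continuously differentiable and positive semidefinite,
and its derivative along the system, `∇S(x) · (A x + B v)`, is at most `vᵀ z - ψ(x)` for all
states `x` and inputs `v`, with an admissible dissipation rate `ψ`. -/
def IsStorageFunction {n p : ℕ} (mode : PassivityMode)
    (A : Matrix (Fin n) (Fin n) ℝ) (B : Matrix (Fin n) (Fin p) ℝ)
    (C : Matrix (Fin p) (Fin n) ℝ) (D : Matrix (Fin p) (Fin p) ℝ)
    (S : (Fin n → ℝ) → ℝ) : Prop :=
  ContDiff ℝ 1 S ∧ IsPosSemidefFun S ∧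
    ∃ ψ : (Fin n → ℝ) → ℝ, IsDissipationRate mode ψ ∧
      ∀ (x : Fin n → ℝ) (v : Fin p → ℝ),
        fderiv ℝ S x (A *ᵥ x + B *ᵥ v) ≤ v ⬝ᵥ (C *ᵥ x + D *ᵥ v) - ψ x

/-- (Strict) passivity of the system `x' = A x + B v`, `z = C x + D v`. -/
def IsPassive {n p : ℕ} (mode : PassivityMode)
    (A : Matrix (Fin n) (Fin n) ℝ) (B : Matrix (Fin n) (Fin p) ℝ)
    (C : Matrix (Fin p) (Fin n) ℝ) (D : Matrix (Fin p) (Fin p) ℝ) : Prop :=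
  ∃ S : (Fin n → ℝ) → ℝ, IsStorageFunction mode A B C D S

/-- The pair `(A, B)` is controllable: `[B, A B, …, Aⁿ⁻¹ B]` has rank `n`. -/
def IsControllable {n p : ℕ}
    (A : Matrix (Fin n) (Fin n) ℝ) (B : Matrix (Fin n) (Fin p) ℝ) : Prop :=
  (Matrix.of fun (i : Fin n) (kj : Fin n × Fin p) => (A ^ (kj.1 : ℕ) * B) i kj.2).rank = n

/-- The pair `(A, C)` is observable: the stacked matrix with block rows
`C, C A, …, C Aⁿ⁻¹` has rank `n`. -/
def IsObservable {n p : ℕ}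
    (A : Matrix (Fin n) (Fin n) ℝ) (C : Matrix (Fin p) (Fin n) ℝ) : Prop :=
  (Matrix.of fun (ki : Fin n × Fin p) (j : Fin n) => (C * A ^ (ki.1 : ℕ)) ki.2 j).rank = n

/-- The closed-loop state matrix `A_K = A - B_u K` under the feedback `u = -K x`. -/
def closedLoop {n m : ℕ} (A : Matrix (Fin n) (Fin n) ℝ) (Bu : Matrix (Fin n) (Fin m) ℝ)
    (K : Matrix (Fin m) (Fin n) ℝ) : Matrix (Fin n) (Fin n) ℝ :=
  A - Bu * K

/-- `N_0(Z, W) = Z Aᵀ + A Z - Wᵀ B_uᵀ - B_u W`. -/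
def N0 {n m : ℕ} (A : Matrix (Fin n) (Fin n) ℝ) (Bu : Matrix (Fin n) (Fin m) ℝ)
    (Z : Matrix (Fin n) (Fin n) ℝ) (W : Matrix (Fin m) (Fin n) ℝ) : Matrix (Fin n) (Fin n) ℝ :=
  Z * Aᵀ + A * Z - Wᵀ * Buᵀ - Bu * W

/-- `N_D(Z, W)`, the block matrix of the inequality for `D ≠ 0`. -/
def ND {n m p : ℕ} (A : Matrix (Fin n) (Fin n) ℝ) (Bu : Matrix (Fin n) (Fin m) ℝ)
    (Bd : Matrix (Fin n) (Fin p) ℝ) (C : Matrix (Fin p) (Fin n) ℝ) (D : Matrix (Fin p) (Fin p) ℝ)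
    (Z : Matrix (Fin n) (Fin n) ℝ) (W : Matrix (Fin m) (Fin n) ℝ) :
    Matrix (Fin n ⊕ Fin p) (Fin n ⊕ Fin p) ℝ :=
  Matrix.fromBlocks (Z * Aᵀ + A * Z - Wᵀ * Buᵀ - Bu * W) (Bd - Z * Cᵀ)
    (Bdᵀ - C * Z) (-D - Dᵀ)

/-- The matrix inequality condition on `(Z, W)`: `N_D(Z, W) ⪯ₛ 0` if `D ≠ 0`, and
`N_0(Z, W) ⪯ₛ 0` together with `B_dᵀ = C Z` if `D = 0`. -/
def SatisfiesLMI {n m p : ℕ} (mode : PassivityMode)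
    (A : Matrix (Fin n) (Fin n) ℝ) (Bu : Matrix (Fin n) (Fin m) ℝ)
    (Bd : Matrix (Fin n) (Fin p) ℝ) (C : Matrix (Fin p) (Fin n) ℝ) (D : Matrix (Fin p) (Fin p) ℝ)
    (Z : Matrix (Fin n) (Fin n) ℝ) (W : Matrix (Fin m) (Fin n) ℝ) : Prop :=
  (D ≠ 0 → NegS mode (ND A Bu Bd C D Z W)) ∧
    (D = 0 → NegS mode (N0 A Bu Z W) ∧ Bdᵀ = C * Z)

end

/-!
Put `P = Z⁻¹` and `W = K Z`. The congruence by `diag(P, 1)` turns the matrix inequality into the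
dissipation inequality for the storage function `x ⬝ᵥ P *ᵥ x / 2` (`negS_ND_iff`, `negS_N0_iff`),
which settles sufficiency. For necessity, a storage function `S` that is merely `C¹` has to be
replaced by a positive definite quadratic one. No trajectories driven by general inputs are needed.

*Strict inequalities* (`exists_quadratic_of_strict_dissipation`). Suppose that
`∇S(X e) ⬝ F e < e ⬝ Q e` for all `e ≠ 0`, with `X`, `F` linear. If no symmetric `P` satisfies
`X e ⬝ P F e < e ⬝ Q e` for all `e ≠ 0`, separation in the space of matrices yields a nonzero
`M = Lᵀ L` with `F M Xᵀ` skew and `tr (M Q) ≤ 0`. After passing from `X`, `F` to `X Lᵀ`, `F Lᵀ`, the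
field `w ↦ F w` is, modulo a term that is odd under the reflection in `ker X`, of the form `X Ω w`
with `Ω` skew. Along the rotations `exp (t Ω)` the sum of `S (X w)` over an orthonormal frame is
bounded, but its derivative is bounded above by a negative constant, because a quadratic form sums
to its trace over every orthonormal frame (`trace_pos_of_strict_dissipation`).

*Nonstrict inequalities* (`IsControllable.exists_quadratic_of_dissipation`). Perturb the supply rate
by `ε (|x|² + |v|²)` and let `ε → 0`. The sets of solutions are compact, since controllability makes
their recession cone trivial.

*Strict inequalities without feedthrough*
(`exists_quadratic_of_strict_of_no_feedthrough`). Here the inequality is not strict in `v`, and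
`P B = Cᵀ` is forced. It also forces `∇S(x) ⬝ B v = v ⬝ C x`, so `S` is explicitly quadratic along
`im B`; splitting off this part leaves a strict inequality on the state space.

*Positivity* (`IsObservable.posDef_of_dissipation`). Under the output feedback `v = -z` both `S` and
the quadratic function decrease at rate at least `|z|²`. As `S ≥ 0`, observability forces all
trajectories to the origin, so the strictly decreasing quadratic function is positive.
-/

/-! ### Inner inverses and linear flows -/

/-- A symmetric real matrix has a symmetric inner inverse: in an orthonormal eigenbasis, invert the
nonzero eigenvalues. -/
theorem exists_isSymm_innerInverse {n : Type*} [Fintype n] [DecidableEq n] {S : Matrix n n ℝ}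
    (hS : S.IsSymm) : ∃ H : Matrix n n ℝ, H.IsSymm ∧ S * H * S = S := by
  have hH : S.IsHermitian := by simpa [Matrix.IsHermitian] using hS.eq
  set U : Matrix n n ℝ := (hH.eigenvectorUnitary : Matrix n n ℝ) with hU
  have hUU : star U * U = 1 := Unitary.star_mul_self_of_mem hH.eigenvectorUnitary.2
  have hst : star U = Uᵀ := by ext; simp [Matrix.star_apply]
  rw [hst] at hUU
  have hspec : S = U * Matrix.diagonal hH.eigenvalues * Uᵀ := by
    have := hH.spectral_theorem
    rw [Unitary.conjStarAlgAut_apply] at this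
    rw [← hst]
    exact this
  refine ⟨U * Matrix.diagonal (fun i => (hH.eigenvalues i)⁻¹) * Uᵀ, ?_, ?_⟩
  · simp [Matrix.IsSymm, Matrix.transpose_mul, Matrix.mul_assoc]
  · have key : Matrix.diagonal hH.eigenvalues * Matrix.diagonal (fun i => (hH.eigenvalues i)⁻¹) *
        Matrix.diagonal hH.eigenvalues = Matrix.diagonal hH.eigenvalues := by
      rw [Matrix.diagonal_mul_diagonal, Matrix.diagonal_mul_diagonal]
      congr 1
      ext i
      exact mul_inv_mul_cancel _
    generalize hH.eigenvalues = l at hspec key ⊢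
    rw [hspec]
    calc _ = U * (Matrix.diagonal l * (Uᵀ * U) *
          Matrix.diagonal (fun i => (l i)⁻¹) * (Uᵀ * U) * Matrix.diagonal l) * Uᵀ := by
            simp only [Matrix.mul_assoc]
      _ = _ := by rw [hUU, Matrix.mul_one, Matrix.mul_one, key]

theorem transpose_mul_self_eq_zero {m n : Type*} [Fintype m] [Fintype n] {A : Matrix m n ℝ}
    (h : Aᵀ * A = 0) : A = 0 := by
  rw [← Matrix.conjTranspose_eq_transpose_of_trivial] at h
  exact Matrix.conjTranspose_mul_self_eq_zero.mp h

/-- Two of the Penrose conditions: `G * X` is the orthogonal projection onto `(ker X)ᗮ`. -/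
theorem exists_mul_mul_self_eq {n m : Type*} [Fintype n] [Fintype m] [DecidableEq n]
    (X : Matrix n m ℝ) : ∃ G : Matrix m n ℝ, X * G * X = X ∧ (G * X).IsSymm := by
  obtain ⟨H, hH, hS⟩ := exists_isSymm_innerInverse (S := X * Xᵀ) (by
    simp [Matrix.IsSymm, Matrix.transpose_mul])
  refine ⟨Xᵀ * H, ?_, ?_⟩
  · have : (X * (Xᵀ * H) * X - X)ᵀ = 0 := by
      apply transpose_mul_self_eq_zero
      have h1 : (X * (Xᵀ * H) * X - X) * Xᵀ = 0 := by
        rw [Matrix.sub_mul, sub_eq_zero]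
        simpa only [Matrix.mul_assoc] using hS
      rw [Matrix.transpose_transpose, Matrix.transpose_sub, Matrix.mul_sub,
        Matrix.transpose_mul _ X, ← Matrix.mul_assoc, h1, Matrix.zero_mul, sub_zero]
    rwa [Matrix.transpose_eq_zero, sub_eq_zero] at this
  · simp [Matrix.IsSymm, Matrix.transpose_mul, hH.eq, Matrix.mul_assoc]

open scoped Matrix.Norms.Operator in
/-- The matrix exponential as the flow of `x' = A x`. -/
theorem exists_linear_flow {n : Type*} [Fintype n] [DecidableEq n] (A : Matrix n n ℝ) :
    ∃ E : ℝ → Matrix n n ℝ, E 0 = 1 ∧ (∀ t v, HasDerivAt (fun s => E s *ᵥ v) (A *ᵥ (E t *ᵥ v)) t) ∧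
      (Aᵀ = -A → ∀ t, (E t)ᵀ * E t = 1) := by
  refine ⟨fun t => NormedSpace.exp (t • A), by simp, fun t v => ?_, fun hA t => ?_⟩
  · have h := hasDerivAt_exp_smul_const' (𝕂 := ℝ) A t
    let φ : Matrix n n ℝ →L[ℝ] (n → ℝ) :=
      LinearMap.toContinuousLinearMap ((Matrix.mulVecBilin ℝ ℝ).flip v)
    have h2 := φ.hasFDerivAt.comp_hasDerivAt t h
    rw [Matrix.mulVec_mulVec]
    exact h2
  · rw [← Matrix.exp_transpose, Matrix.transpose_smul, hA, smul_neg, Matrix.exp_neg]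
    exact Matrix.nonsing_inv_mul _ ((Matrix.isUnit_iff_isUnit_det _).mp (Matrix.isUnit_exp _))

theorem isCompact_orthogonal (n : Type*) [Fintype n] [DecidableEq n] :
    IsCompact {O : Matrix n n ℝ | Oᵀ * O = 1} := by
  refine IsCompact.of_isClosed_subset
    (s := Set.univ.pi fun _ => Set.univ.pi fun _ => Set.Icc (-1) 1)
    (isCompact_univ_pi fun _ => isCompact_univ_pi fun _ => isCompact_Icc) ?_ ?_
  · exact isClosed_eq (by fun_prop) continuous_const
  · intro O hO i _ j _
    have h : ∑ k, O k j * O k j = 1 := by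
      have := congrFun (congrFun hO j) j
      exact this.trans (Matrix.one_apply_eq j)
    have : O i j * O i j ≤ 1 := by
      rw [← h]
      exact Finset.single_le_sum (f := fun k => O k j * O k j)
        (fun k _ => mul_self_nonneg _) (Finset.mem_univ i)
    exact abs_le.mp (abs_le_one_iff_mul_self_le_one.mpr this)


/-! ### Averaging over orthonormal frames -/

/-- The averaging argument. If `F Xᵀ` is skew, then `F` may be replaced, up to a term that cancels
under a reflection, by `X Ω` with `Ω` skew; `w' = Ω w` is then a flow by rotations, along which the
sum of `S (X w)` over an orthonormal frame stays bounded, while the sum of `w ⬝ᵥ Q *ᵥ w` is the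
constant `trace Q`. -/
theorem trace_pos_of_strict_dissipation {n m N : Type*} [Fintype n] [Fintype m] [Fintype N]
    [DecidableEq n] [DecidableEq N] {X F : Matrix n N ℝ} (hskew : F * Xᵀ + X * Fᵀ = 0)
    {Q : Matrix N N ℝ} {L : Matrix m N ℝ} (hL : L ≠ 0) {S : (n → ℝ) → ℝ} (hS : ContDiff ℝ 1 S)
    (hle : ∀ w, fderiv ℝ S (X *ᵥ w) (F *ᵥ w) ≤ w ⬝ᵥ (Q *ᵥ w))
    (hlt : ∀ w, L *ᵥ w ≠ 0 → fderiv ℝ S (X *ᵥ w) (F *ᵥ w) < w ⬝ᵥ (Q *ᵥ w)) :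
    0 < Q.trace := by
  by_contra! htr
  have hS' : Continuous (fderiv ℝ S) := hS.continuous_fderiv one_ne_zero
  let e : N → N → ℝ := fun i => Pi.single i 1
  let Φ : Matrix N N ℝ → ℝ := fun O =>
    ∑ i, fderiv ℝ S (X *ᵥ (O *ᵥ e i)) (F *ᵥ (O *ᵥ e i))
  have hΦc : Continuous Φ := by
    refine continuous_finsetSum _ fun i _ => ?_
    exact (hS'.comp (by fun_prop)).clm_apply (by fun_prop)
  -- over an orthonormal frame the quadratic form sums to its trace
  have hΦneg : ∀ O ∈ {O : Matrix N N ℝ | Oᵀ * O = 1}, Φ O < 0 := by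
    intro O hO
    have hO' : O * Oᵀ = 1 := mul_eq_one_comm.mp hO
    have hsum : ∑ i, (O *ᵥ e i) ⬝ᵥ (Q *ᵥ (O *ᵥ e i)) = Q.trace := by
      have h1 : ∀ i, (O *ᵥ e i) ⬝ᵥ (Q *ᵥ (O *ᵥ e i)) = (Oᵀ * (Q * O)) i i := by
        intro i
        rw [Matrix.mulVec_mulVec, ← Matrix.vecMul_transpose, ← Matrix.dotProduct_mulVec,
          Matrix.mulVec_mulVec]
        simp [e]
      simp_rw [h1]
      change (Oᵀ * (Q * O)).trace = _
      rw [Matrix.trace_mul_comm, Matrix.mul_assoc, hO', Matrix.mul_one]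
    have hex : ∃ i, L *ᵥ (O *ᵥ e i) ≠ 0 := by
      by_contra! hall
      apply hL
      have h2 : L * O = 0 := by
        ext a b
        have := congrFun (hall b) a
        rw [Matrix.mulVec_mulVec] at this
        simpa [e] using this
      calc L = L * (O * Oᵀ) := by rw [hO', Matrix.mul_one]
        _ = 0 := by rw [← Matrix.mul_assoc, h2, Matrix.zero_mul]
    obtain ⟨i, hi⟩ := hex
    have := Finset.sum_lt_sum (s := Finset.univ)
      (fun i _ => hle (O *ᵥ e i)) ⟨i, Finset.mem_univ i, hlt _ hi⟩
    exact (this.trans_eq hsum).trans_le htr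
  obtain ⟨O₁, hO₁, hmax⟩ := (isCompact_orthogonal N).exists_isMaxOn ⟨1, by simp⟩ hΦc.continuousOn
  -- on `(ker X)ᗮ`, the range of the projection `G X`, the field `F` equals `X Ω` with `Ω` skew
  obtain ⟨G, hG, hGs⟩ := exists_mul_mul_self_eq X
  have hFX : F * Xᵀ = -(X * Fᵀ) := eq_neg_of_add_eq_zero_left hskew
  have hGX : G * X = Xᵀ * Gᵀ := by rw [← Matrix.transpose_mul, hGs.eq]
  let Ω : Matrix N N ℝ := G * F * G * X
  have hFGX : F * (G * X) = -(X * (Fᵀ * Gᵀ)) := by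
    rw [hGX, ← Matrix.mul_assoc, hFX, Matrix.neg_mul, Matrix.mul_assoc]
  have hXΩ : X * Ω = F * (G * X) := by
    calc X * Ω = X * G * (F * (G * X)) := by simp only [Ω, Matrix.mul_assoc]
      _ = F * (G * X) := by
        rw [hFGX, Matrix.mul_neg, ← Matrix.mul_assoc, hG]
  have hΩ : Ωᵀ = -Ω := by
    have h1 : Ω = G * (F * Xᵀ) * Gᵀ := by
      calc Ω = G * F * (G * X) := by simp only [Ω, Matrix.mul_assoc]
        _ = _ := by rw [hGX]; simp only [Matrix.mul_assoc]
    have h2 : Ωᵀ = G * (X * Fᵀ) * Gᵀ := by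
      rw [h1]; simp [Matrix.transpose_mul, Matrix.mul_assoc]
    rw [h2, h1, hFX]; simp
  -- the reflection fixing `(ker X)ᗮ` and reversing `ker X`
  let R : Matrix N N ℝ := 2 • (G * X) - 1
  have hXR : X * R = X := by
    simp only [R, Matrix.mul_sub, Matrix.mul_smul, ← Matrix.mul_assoc, hG, Matrix.mul_one]
    rw [two_smul, add_sub_cancel_right]
  have hRR : Rᵀ * R = 1 := by
    have hPP : G * X * (G * X) = G * X := by
      rw [Matrix.mul_assoc, ← Matrix.mul_assoc X, hG]
    have hRt : Rᵀ = R := by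
      simp only [R, Matrix.transpose_sub, Matrix.transpose_smul, hGs.eq, Matrix.transpose_one]
    rw [hRt]
    simp only [R, two_smul, Matrix.sub_mul, Matrix.mul_sub, Matrix.add_mul, Matrix.mul_add, hPP,
      Matrix.mul_one, Matrix.one_mul]
    abel
  obtain ⟨E, -, hE, hEo⟩ := exists_linear_flow Ω
  let φ : ℝ → ℝ := fun t => ∑ i, S (X *ᵥ (E t *ᵥ e i))
  have hφ : ∀ t, HasDerivAt φ
      (∑ i, fderiv ℝ S (X *ᵥ (E t *ᵥ e i)) (X *ᵥ (Ω *ᵥ (E t *ᵥ e i)))) t := by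
    intro t
    refine HasDerivAt.fun_sum fun i _ => ?_
    have h1 : HasDerivAt (fun s => X *ᵥ (E s *ᵥ e i)) (X *ᵥ (Ω *ᵥ (E t *ᵥ e i))) t :=
      (LinearMap.toContinuousLinearMap (Matrix.mulVecLin X)).hasFDerivAt.comp_hasDerivAt t
        (hE t (e i))
    exact ((hS.differentiable one_ne_zero) _).hasFDerivAt.comp_hasDerivAt t h1
  have hφ' : ∀ t, ∑ i, fderiv ℝ S (X *ᵥ (E t *ᵥ e i)) (X *ᵥ (Ω *ᵥ (E t *ᵥ e i))) ≤ Φ O₁ := by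
    intro t
    have hEt : E t ∈ {O : Matrix N N ℝ | Oᵀ * O = 1} := hEo hΩ t
    have hREt : R * E t ∈ {O : Matrix N N ℝ | Oᵀ * O = 1} := by
      change (R * E t)ᵀ * (R * E t) = 1
      rw [Matrix.transpose_mul, Matrix.mul_assoc, ← Matrix.mul_assoc Rᵀ, hRR, Matrix.one_mul]
      exact hEt
    have hadd : Φ (E t) + Φ (R * E t) =
        2 * ∑ i, fderiv ℝ S (X *ᵥ (E t *ᵥ e i)) (X *ᵥ (Ω *ᵥ (E t *ᵥ e i))) := by
      simp only [Φ]
      rw [← Finset.sum_add_distrib, Finset.mul_sum]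
      refine Finset.sum_congr rfl fun i _ => ?_
      have h1 : X *ᵥ ((R * E t) *ᵥ e i) = X *ᵥ (E t *ᵥ e i) := by
        rw [← Matrix.mulVec_mulVec, Matrix.mulVec_mulVec, hXR]
      have h2 : F *ᵥ (E t *ᵥ e i) + F *ᵥ ((R * E t) *ᵥ e i)
          = (2 : ℝ) • (X *ᵥ (Ω *ᵥ (E t *ᵥ e i))) := by
        rw [← Matrix.mulVec_mulVec, Matrix.mulVec_mulVec _ X, hXΩ, ← Matrix.mulVec_add,
          ← Matrix.mulVec_mulVec]
        simp only [R, Matrix.sub_mulVec, Matrix.one_mulVec, Matrix.smul_mulVec,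
          add_sub_cancel, Matrix.mulVec_smul]
        norm_cast
      rw [h1, ← map_add, h2, map_smul, smul_eq_mul]
    have ha := hmax hEt
    have hb := hmax hREt
    simp only [Set.mem_ofPred_eq] at ha hb
    linarith
  have hφd : Differentiable ℝ φ := fun t => (hφ t).differentiableAt
  have hup : ∀ t, 0 ≤ t → φ t ≤ φ 0 + Φ O₁ * t := by
    intro t ht
    have := Convex.image_sub_le_mul_sub_of_deriv_le (convex_univ) hφd.continuous.continuousOn
      hφd.differentiableOn (C := Φ O₁) (fun x _ => by rw [(hφ x).deriv]; exact hφ' x)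
      0 (Set.mem_univ _) t (Set.mem_univ _) ht
    linarith
  obtain ⟨O₂, -, hmin⟩ := (isCompact_orthogonal N).exists_isMinOn ⟨1, by simp⟩
    (f := fun O : Matrix N N ℝ => ∑ i, S (X *ᵥ (O *ᵥ e i)))
    (continuous_finsetSum _ fun i _ => hS.continuous.comp (by fun_prop)).continuousOn
  have hlow : ∀ t, (∑ i, S (X *ᵥ (O₂ *ᵥ e i))) ≤ φ t := fun t => hmin (hEo hΩ t)
  have hneg : Φ O₁ < 0 := hΦneg O₁ hO₁
  set m₀ := ∑ i, S (X *ᵥ (O₂ *ᵥ e i))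
  have h0 := hlow 0
  have ht : 0 ≤ (φ 0 - m₀ + 1) / (-Φ O₁) := by
    apply div_nonneg <;> linarith
  have h1 := hup _ ht
  have h2 := hlow ((φ 0 - m₀ + 1) / (-Φ O₁))
  have h3 : Φ O₁ * ((φ 0 - m₀ + 1) / (-Φ O₁)) = -(φ 0 - m₀ + 1) := by
    field_simp [hneg.ne]
  linarith

/-! ### Quadratic solutions of strict dissipation inequalities, by duality -/

theorem dotProduct_self_pos {ι : Type*} [Fintype ι] {x : ι → ℝ} (hx : x ≠ 0) : 0 < x ⬝ᵥ x :=
  lt_of_le_of_ne (Finset.sum_nonneg fun i _ => mul_self_nonneg (x i))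
    fun h => hx (dotProduct_self_eq_zero.mp h.symm)

theorem isCompact_dotProduct_self_eq_one (ι : Type*) [Fintype ι] :
    IsCompact {x : ι → ℝ | x ⬝ᵥ x = 1} := by
  refine IsCompact.of_isClosed_subset (s := Set.univ.pi fun _ => Set.Icc (-1) 1)
    (isCompact_univ_pi fun _ => isCompact_Icc) ?_ ?_
  · exact isClosed_eq (by fun_prop) continuous_const
  · intro x hx i _
    have : x i * x i ≤ 1 := by
      rw [← show x ⬝ᵥ x = 1 from hx]
      exact Finset.single_le_sum (f := fun k => x k * x k)
        (fun k _ => mul_self_nonneg _) (Finset.mem_univ i)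
    exact abs_le.mp (abs_le_one_iff_mul_self_le_one.mpr this)

theorem exists_smul_dotProduct_self_eq_one {ι : Type*} [Fintype ι] {x : ι → ℝ} (hx : x ≠ 0) :
    ∃ r : ℝ, ∃ y : ι → ℝ, y ⬝ᵥ y = 1 ∧ x = r • y ∧ r ^ 2 = x ⬝ᵥ x ∧ 0 < r := by
  have hpos := dotProduct_self_pos hx
  have hs : 0 < √(x ⬝ᵥ x) := Real.sqrt_pos.mpr hpos
  refine ⟨√(x ⬝ᵥ x), (√(x ⬝ᵥ x))⁻¹ • x, ?_, ?_, Real.sq_sqrt hpos.le, hs⟩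
  · rw [smul_dotProduct, dotProduct_smul, smul_eq_mul, smul_eq_mul, ← mul_assoc, ← mul_inv,
      Real.mul_self_sqrt hpos.le, inv_mul_cancel₀ hpos.ne']
  · rw [smul_smul, mul_inv_cancel₀ hs.ne', one_smul]

/-- A continuous function that is homogeneous of degree two and positive away from the origin
dominates a multiple of the squared Euclidean norm. -/
theorem exists_mul_dotProduct_self_le {ι : Type*} [Fintype ι] {g : (ι → ℝ) → ℝ}
    (hg : Continuous g) (hhom : ∀ (r : ℝ) x, g (r • x) = r ^ 2 * g x)
    (hpos : ∀ x, x ≠ 0 → 0 < g x) : ∃ c > 0, ∀ x, c * (x ⬝ᵥ x) ≤ g x := by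
  have h0 : g 0 = 0 := by simpa using hhom 0 0
  rcases Set.eq_empty_or_nonempty {x : ι → ℝ | x ⬝ᵥ x = 1} with he | hne
  · refine ⟨1, one_pos, fun x => ?_⟩
    by_cases hx : x = 0
    · simp [hx, h0]
    · obtain ⟨r, y, hy, -⟩ := exists_smul_dotProduct_self_eq_one hx
      exact absurd (show y ∈ {x : ι → ℝ | x ⬝ᵥ x = 1} from hy) (by simp [he])
  · obtain ⟨z, hz, hmin⟩ := (isCompact_dotProduct_self_eq_one ι).exists_isMinOn hne hg.continuousOn
    have hz0 : z ≠ 0 := by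
      rintro rfl
      simp at hz
    refine ⟨g z, hpos z hz0, fun x => ?_⟩
    by_cases hx : x = 0
    · simp [hx, h0]
    · obtain ⟨r, y, hy, rfl, hr, -⟩ := exists_smul_dotProduct_self_eq_one hx
      rw [← hr, hhom, mul_comm]
      exact mul_le_mul_of_nonneg_left (hmin hy) (sq_nonneg r)

theorem isOpen_forall_dotProduct_mulVec_neg (ι : Type*) [Fintype ι] :
    IsOpen {N : Matrix ι ι ℝ | ∀ x, x ≠ 0 → x ⬝ᵥ (N *ᵥ x) < 0} := by
  have hset : {N : Matrix ι ι ℝ | ∀ x, x ≠ 0 → x ⬝ᵥ (N *ᵥ x) < 0} =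
      {N : Matrix ι ι ℝ | ∀ x ∈ {x : ι → ℝ | x ⬝ᵥ x = 1}, x ⬝ᵥ (N *ᵥ x) < 0} := by
    ext N
    refine ⟨fun h x hx => h x ?_, fun h x hx => ?_⟩
    · rintro rfl
      simp at hx
    · obtain ⟨r, y, hy, rfl, -, hr⟩ := exists_smul_dotProduct_self_eq_one hx
      have := h y hy
      simp only [Matrix.mulVec_smul, smul_dotProduct, dotProduct_smul, smul_eq_mul]
      nlinarith [mul_pos hr hr]
  rw [hset, isOpen_iff_mem_nhds]
  intro N hN
  refine (isCompact_dotProduct_self_eq_one ι).eventually_forall_of_forall_eventually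
    (fun x hx => ?_)
  have hc : Continuous fun z : Matrix ι ι ℝ × (ι → ℝ) => z.2 ⬝ᵥ (z.1 *ᵥ z.2) := by fun_prop
  exact hc.continuousAt.eventually_lt continuousAt_const (hN x hx)

/-- Separation: if no symmetric `P` makes `(X e) ⬝ᵥ P *ᵥ (F e)` smaller than `e ⬝ᵥ Q *ᵥ e` for all
`e ≠ 0`, this is witnessed by a nonzero dual matrix `M = Lᵀ L`, orthogonal to all the forms
`(X e) ⬝ᵥ P *ᵥ (F e)` and nonpositive on `Q`. -/
theorem exists_dual_certificate {n ι : Type*} [Fintype n] [Fintype ι] [DecidableEq ι]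
    (X F : Matrix n ι ℝ) (Q : Matrix ι ι ℝ)
    (hno : ¬ ∃ P : Matrix n n ℝ, P.IsSymm ∧
      ∀ e, e ≠ 0 → (X *ᵥ e) ⬝ᵥ (P *ᵥ (F *ᵥ e)) < e ⬝ᵥ (Q *ᵥ e)) :
    ∃ L : Matrix ι ι ℝ, L ≠ 0 ∧ F * (Lᵀ * L) * Xᵀ + X * (Lᵀ * L) * Fᵀ = 0 ∧
      (Lᵀ * L * Q).trace ≤ 0 := by
  let U : Set (Matrix ι ι ℝ) := {N | ∀ x, x ≠ 0 → x ⬝ᵥ (N *ᵥ x) < 0}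
  let B : Matrix n n ℝ → Matrix ι ι ℝ := fun P => Xᵀ * P * F - Q
  let T : Set (Matrix ι ι ℝ) := {N | ∃ P : Matrix n n ℝ, P.IsSymm ∧ N = B P + (B P)ᵀ}
  have hquad : ∀ (N : Matrix ι ι ℝ) x, x ⬝ᵥ (Nᵀ *ᵥ x) = x ⬝ᵥ (N *ᵥ x) := by
    intro N x
    rw [Matrix.mulVec_transpose, dotProduct_comm, ← Matrix.dotProduct_mulVec]
  have hUconv : Convex ℝ U := by
    intro N hN N' hN' a b ha hb hab x hx
    have h1 := hN x hx
    have h2 := hN' x hx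
    simp only [Matrix.add_mulVec, Matrix.smul_mulVec, dotProduct_add, dotProduct_smul, smul_eq_mul]
    rcases ha.eq_or_lt with rfl | ha
    · have : b = 1 := by linarith
      subst this
      linarith
    · nlinarith [mul_neg_of_pos_of_neg ha h1, mul_nonpos_of_nonneg_of_nonpos hb h2.le]
  have hTconv : Convex ℝ T := by
    rintro _ ⟨P, hP, rfl⟩ _ ⟨P', hP', rfl⟩ a b ha hb hab
    refine ⟨a • P + b • P', (hP.smul a).add (hP'.smul b), ?_⟩
    have : B (a • P + b • P') = a • B P + b • B P' := by
      simp only [B, Matrix.mul_add, Matrix.add_mul, Matrix.mul_smul, Matrix.smul_mul, smul_sub]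
      nth_rewrite 1 [← one_smul ℝ Q]
      rw [← hab, add_smul]
      abel
    rw [this]
    simp only [Matrix.transpose_add, Matrix.transpose_smul, smul_add]
    abel
  have hdisj : Disjoint U T := by
    rw [Set.disjoint_left]
    rintro N hN ⟨P, hP, rfl⟩
    refine hno ⟨P, hP, fun e he => ?_⟩
    have := hN e he
    rw [Matrix.add_mulVec, dotProduct_add, hquad] at this
    simp only [B, Matrix.sub_mulVec, dotProduct_sub, ← Matrix.mulVec_mulVec] at this
    rw [Matrix.dotProduct_mulVec e Xᵀ, Matrix.vecMul_transpose] at this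
    linarith
  obtain ⟨g, u, hgU, hgT⟩ := geometric_hahn_banach_open hUconv
    (isOpen_forall_dotProduct_mulVec_neg ι) hTconv hdisj
  -- `g` pairs with symmetrized matrices through the symmetric matrix `M`
  let M : Matrix ι ι ℝ := fun i j => g (Matrix.single i j 1) + g (Matrix.single j i 1)
  have hMs : M.IsSymm := by
    ext i j
    exact add_comm _ _
  have hg : ∀ N, g N = ∑ i, ∑ j, N i j * g (Matrix.single i j 1) := by
    intro N
    conv_lhs => rw [Matrix.matrix_eq_sum_single N]
    simp only [map_sum]
    refine Finset.sum_congr rfl fun i _ => Finset.sum_congr rfl fun j _ => ?_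
    rw [show Matrix.single i j (N i j) = N i j • Matrix.single i j (1 : ℝ) by simp, map_smul,
      smul_eq_mul]
  have hgM : ∀ N, g (N + Nᵀ) = (M * N).trace := by
    intro N
    rw [map_add, hg N, hg Nᵀ, Finset.sum_comm (f := fun i j => Nᵀ i j * _)]
    simp only [Matrix.trace, Matrix.diag, Matrix.mul_apply, Matrix.transpose_apply]
    rw [Finset.sum_comm (f := fun i j => M i j * N j i)]
    simp only [← Finset.sum_add_distrib, M]
    refine Finset.sum_congr rfl fun i _ => Finset.sum_congr rfl fun j _ => ?_
    ring
  -- scaling inside the cone `U`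
  have hU0 : 0 ≤ u ∧ ∀ N ∈ U, g N ≤ 0 := by
    have hsc : ∀ N ∈ U, ∀ t : ℝ, 0 < t → t * g N < u := by
      intro N hN t ht
      have : t • N ∈ U := by
        intro x hx
        rw [Matrix.smul_mulVec, dotProduct_smul, smul_eq_mul]
        exact mul_neg_of_pos_of_neg ht (hN x hx)
      simpa using hgU _ this
    constructor
    · by_contra! hu
      have h1 : (-1 : Matrix ι ι ℝ) ∈ U := by
        intro x hx
        simpa [Matrix.neg_mulVec] using dotProduct_self_pos hx
      have h2 := hsc _ h1 1 one_pos
      have h3 := hsc _ h1 (u / (2 * g (-1)))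
        (div_pos_of_neg_of_neg hu (by linarith))
      have h4 : u / (2 * g (-1)) * g (-1) = u / 2 := by
        have : g (-1) ≠ 0 := by intro h; rw [h] at h2; linarith
        field_simp
      linarith
    · intro N hN
      by_contra! hpos
      have h1 := hsc N hN ((|u| + 1) / g N) (by positivity)
      rw [div_mul_cancel₀ _ hpos.ne'] at h1
      linarith [le_abs_self u]
  have hMpsd : M.PosSemidef := by
    refine Matrix.PosSemidef.of_dotProduct_mulVec_nonneg
      (by simpa [Matrix.IsHermitian] using hMs.eq) fun x => ?_
    have hlim : ∀ ε : ℝ, 0 < ε → g (-(Matrix.vecMulVec x x) - ε • 1) ≤ 0 := by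
      intro ε hε
      refine hU0.2 _ fun y hy => ?_
      have h1 := dotProduct_self_pos hy
      simp only [Matrix.sub_mulVec, Matrix.neg_mulVec, Matrix.smul_mulVec, Matrix.one_mulVec,
        dotProduct_sub, dotProduct_neg, dotProduct_smul, smul_eq_mul, Matrix.vecMulVec_mulVec,
        op_smul_eq_smul, dotProduct_comm y x]
      nlinarith [mul_self_nonneg (x ⬝ᵥ y), mul_pos hε h1]
    have hx0 : 0 ≤ g (Matrix.vecMulVec x x) := by
      by_contra! hneg
      have h1 := hlim (-g (Matrix.vecMulVec x x) / (2 * (|g 1| + 1)))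
        (div_pos (by linarith) (by positivity))
      rw [map_sub, map_neg, map_smul, smul_eq_mul] at h1
      have h2 : -g (Matrix.vecMulVec x x) / (2 * (|g 1| + 1)) * g 1 ≤
          -g (Matrix.vecMulVec x x) / 2 := by
        rw [div_mul_eq_mul_div, div_le_div_iff₀ (by positivity) two_pos]
        nlinarith [le_abs_self (g 1), mul_le_mul_of_nonneg_left (le_abs_self (g 1))
          (show 0 ≤ -g (Matrix.vecMulVec x x) by linarith)]
      linarith
    have h1 := hgM (Matrix.vecMulVec x x)
    have h2 : (Matrix.vecMulVec x x)ᵀ = Matrix.vecMulVec x x := by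
      ext i j; simp [Matrix.vecMulVec_apply, mul_comm]
    have h3 : (M * Matrix.vecMulVec x x).trace = x ⬝ᵥ (M *ᵥ x) := by
      rw [Matrix.mul_vecMulVec, Matrix.trace_vecMulVec, dotProduct_comm]
    rw [h2, map_add, h3] at h1
    simp only [star_trivial]
    linarith
  -- on `T` the functional is an affine function of `P`, bounded below
  have hbd : ∀ P : Matrix n n ℝ, P.IsSymm → u ≤ (M * (Xᵀ * P * F)).trace - (M * Q).trace := by
    intro P hP
    have := hgT _ ⟨P, hP, rfl⟩
    rwa [hgM, Matrix.mul_sub, Matrix.trace_sub] at this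
  have hzero : ∀ P : Matrix n n ℝ, P.IsSymm → (M * (Xᵀ * P * F)).trace = 0 := by
    intro P hP
    by_contra hne
    set a := (M * (Xᵀ * P * F)).trace with ha
    have := hbd (((u + (M * Q).trace - 1) / a) • P) (hP.smul _)
    rw [Matrix.mul_smul, Matrix.smul_mul, Matrix.mul_smul, Matrix.trace_smul, smul_eq_mul, ← ha,
      div_mul_cancel₀ _ hne] at this
    linarith
  have hMQ : (M * Q).trace ≤ 0 := by
    have := hbd 0 Matrix.isSymm_zero
    simp only [Matrix.mul_zero, Matrix.zero_mul, Matrix.trace_zero] at this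
    linarith [hU0.1]
  have hM0 : M ≠ 0 := by
    intro h
    have h1 : ∀ N, g (N + Nᵀ) = 0 := fun N => by simp [hgM, h]
    have h2 := hgT _ ⟨0, Matrix.isSymm_zero, rfl⟩
    rw [h1] at h2
    have h3 : ((-1 : Matrix ι ι ℝ) + (-1)ᵀ) ∈ U := by
      intro x hx
      have := dotProduct_self_pos hx
      simp only [Matrix.transpose_neg, Matrix.transpose_one, Matrix.add_mulVec, Matrix.neg_mulVec,
        Matrix.one_mulVec, dotProduct_add, dotProduct_neg]
      linarith
    have h4 := hgU _ h3
    rw [h1] at h4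
    linarith
  obtain ⟨L, hL⟩ : ∃ L : Matrix ι ι ℝ, M = Lᴴ * L := by
    open scoped MatrixOrder Matrix.Norms.L2Operator in
    exact CStarAlgebra.nonneg_iff_eq_star_mul_self.mp hMpsd.nonneg
  rw [Matrix.conjTranspose_eq_transpose_of_trivial] at hL
  refine ⟨L, ?_, ?_, ?_⟩
  · rintro rfl
    exact hM0 (by simp [hL])
  · rw [← hL]
    set K := F * M * Xᵀ with hK
    have hKt : X * M * Fᵀ = Kᵀ := by
      simp [hK, Matrix.transpose_mul, hMs.eq, Matrix.mul_assoc]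
    rw [hKt]
    have hsymm : (K + Kᵀ).IsSymm := by
      simp [Matrix.IsSymm, add_comm]
    have h1 : (K * (K + Kᵀ)).trace = 0 := by
      rw [← hzero _ hsymm, ← Matrix.mul_assoc, Matrix.trace_mul_comm _ F, hK]
      simp only [Matrix.mul_assoc]
    have h2 : (Kᵀ * (K + Kᵀ)).trace = 0 := by
      rw [← Matrix.trace_transpose, Matrix.transpose_mul, hsymm.eq, Matrix.transpose_transpose,
        Matrix.trace_mul_comm, h1]
    have h3 : ((K + Kᵀ)ᴴ * (K + Kᵀ)).trace = 0 := by
      rw [Matrix.conjTranspose_eq_transpose_of_trivial, hsymm.eq, Matrix.add_mul, Matrix.trace_add,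
        h1, h2, add_zero]
    exact Matrix.trace_conjTranspose_mul_self_eq_zero_iff.mp h3
  · rwa [← hL]

/-- A strict dissipation inequality with quadratic supply rate that has a `C¹` storage function has
a quadratic one. The pair `(X e, F e)` is thought of as a state together with its velocity; `S` need
be neither nonnegative nor homogeneous. -/
theorem exists_quadratic_of_strict_dissipation {n ι : Type*} [Fintype n] [DecidableEq n]
    [Fintype ι] [DecidableEq ι] (X F : Matrix n ι ℝ) (Q : Matrix ι ι ℝ) {S : (n → ℝ) → ℝ}
    (hS : ContDiff ℝ 1 S)
    (h : ∀ e, e ≠ 0 → fderiv ℝ S (X *ᵥ e) (F *ᵥ e) < e ⬝ᵥ (Q *ᵥ e)) :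
    ∃ P : Matrix n n ℝ, P.IsSymm ∧
      ∀ e, e ≠ 0 → (X *ᵥ e) ⬝ᵥ (P *ᵥ (F *ᵥ e)) < e ⬝ᵥ (Q *ᵥ e) := by
  by_contra hno
  obtain ⟨L, hL, hskew, htr⟩ := exists_dual_certificate X F Q hno
  have hquad : ∀ w, w ⬝ᵥ ((L * Q * Lᵀ) *ᵥ w) = (Lᵀ *ᵥ w) ⬝ᵥ (Q *ᵥ (Lᵀ *ᵥ w)) := by
    intro w
    rw [← Matrix.mulVec_mulVec, ← Matrix.mulVec_mulVec, Matrix.dotProduct_mulVec w L,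
      Matrix.mulVec_transpose]
  have hlt : ∀ w, Lᵀ *ᵥ w ≠ 0 →
      fderiv ℝ S ((X * Lᵀ) *ᵥ w) ((F * Lᵀ) *ᵥ w) < w ⬝ᵥ ((L * Q * Lᵀ) *ᵥ w) := by
    intro w hw
    rw [hquad, ← Matrix.mulVec_mulVec, ← Matrix.mulVec_mulVec]
    exact h _ hw
  have hle : ∀ w, fderiv ℝ S ((X * Lᵀ) *ᵥ w) ((F * Lᵀ) *ᵥ w) ≤ w ⬝ᵥ ((L * Q * Lᵀ) *ᵥ w) := by
    intro w
    by_cases hw : Lᵀ *ᵥ w = 0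
    · rw [hquad, ← Matrix.mulVec_mulVec, ← Matrix.mulVec_mulVec, hw]
      simp
    · exact (hlt w hw).le
  have hpos := trace_pos_of_strict_dissipation (X := X * Lᵀ) (F := F * Lᵀ)
    (by simpa only [Matrix.transpose_mul, Matrix.transpose_transpose, Matrix.mul_assoc] using hskew)
    (L := Lᵀ) (by simpa using hL) hS hle hlt
  rw [Matrix.trace_mul_comm, ← Matrix.mul_assoc] at hpos
  linarith

/-! ### Nonstrict dissipation inequalities for controllable systems -/

theorem IsControllable.eq_zero_of_mul_eq_zero {n p : ℕ} {A : Matrix (Fin n) (Fin n) ℝ}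
    {B : Matrix (Fin n) (Fin p) ℝ} (h : IsControllable A B) {R : Matrix (Fin n) (Fin n) ℝ}
    (hR : ∀ k : ℕ, R * (A ^ k * B) = 0) : R = 0 := by
  set M : Matrix (Fin n) (Fin n × Fin p) ℝ :=
    Matrix.of fun i kj => (A ^ (kj.1 : ℕ) * B) i kj.2 with hM
  have hrank : M.rank = n := h
  have htop : LinearMap.range M.mulVecLin = ⊤ := by
    apply Submodule.eq_top_of_finrank_eq
    rw [Module.finrank_fin_fun]
    exact hrank
  have hRM : R * M = 0 := by
    ext i kj
    have := congrFun (congrFun (hR kj.1) i) kj.2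
    simpa [Matrix.mul_apply, hM] using this
  rw [← Matrix.mulVec_injective.eq_iff (a := R)]
  funext x
  obtain ⟨y, rfl⟩ : x ∈ LinearMap.range M.mulVecLin := htop ▸ Submodule.mem_top
  rw [Matrix.mulVecLin_apply, Matrix.mulVec_mulVec, hRM]
  simp

theorem IsObservable.eq_zero_of_mulVec_eq_zero {n p : ℕ} {A : Matrix (Fin n) (Fin n) ℝ}
    {C : Matrix (Fin p) (Fin n) ℝ} (h : IsObservable A C) {x : Fin n → ℝ}
    (hx : ∀ k : ℕ, C *ᵥ (A ^ k *ᵥ x) = 0) : x = 0 := by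
  set M : Matrix (Fin n × Fin p) (Fin n) ℝ :=
    Matrix.of fun ki j => (C * A ^ (ki.1 : ℕ)) ki.2 j with hM
  have hrank : M.rank = n := h
  have hker : LinearMap.ker M.mulVecLin = ⊥ := by
    have h1 := M.mulVecLin.finrank_range_add_finrank_ker
    rw [Module.finrank_fin_fun] at h1
    have h2 : Module.finrank ℝ (LinearMap.range M.mulVecLin) = n := hrank
    exact Submodule.finrank_eq_zero.mp (by omega)
  have : x ∈ LinearMap.ker M.mulVecLin := by
    rw [LinearMap.mem_ker, Matrix.mulVecLin_apply]
    funext ki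
    have := congrFun (hx ki.1) ki.2
    rw [Matrix.mulVec_mulVec] at this
    simpa [Matrix.mulVec, dotProduct, hM] using this
  rwa [hker, Submodule.mem_bot] at this

theorem Matrix.IsSymm.dotProduct_mulVec_comm {n : Type*} [Fintype n] {P : Matrix n n ℝ}
    (hP : P.IsSymm) (x y : n → ℝ) : x ⬝ᵥ (P *ᵥ y) = y ⬝ᵥ (P *ᵥ x) := by
  rw [Matrix.dotProduct_mulVec, ← Matrix.mulVec_transpose, hP.eq, dotProduct_comm]

theorem linear_coeff_eq_zero {a b : ℝ} (h : ∀ t : ℝ, t * a + t ^ 2 * b ≤ 0) : a = 0 := by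
  by_contra ha
  have h1 := h (a / (|b| + 1))
  have hb : 0 < |b| + 1 := by positivity
  have h2 : a / (|b| + 1) * a + (a / (|b| + 1)) ^ 2 * b =
      a ^ 2 * (|b| + 1 + b) / (|b| + 1) ^ 2 := by
    field_simp
  rw [h2] at h1
  have : 0 < a ^ 2 * (|b| + 1 + b) / (|b| + 1) ^ 2 := by
    have : 0 < |b| + 1 + b := by linarith [neg_abs_le b]
    positivity
  linarith

/-- For a controllable pair the dissipation inequality with zero supply has only the trivial
quadratic solution: it forces `R B = 0`, and `ker R` is invariant under `A`. -/
theorem IsControllable.eq_zero_of_dissipation {n p : ℕ} {A : Matrix (Fin n) (Fin n) ℝ}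
    {B : Matrix (Fin n) (Fin p) ℝ} (hAB : IsControllable A B) {R : Matrix (Fin n) (Fin n) ℝ}
    (hR : R.IsSymm) (h : ∀ x v, x ⬝ᵥ (R *ᵥ (A *ᵥ x + B *ᵥ v)) ≤ 0) : R = 0 := by
  have hA : ∀ x, x ⬝ᵥ (R *ᵥ (A *ᵥ x)) ≤ 0 := fun x => by simpa using h x 0
  have hinv : ∀ w, R *ᵥ w = 0 → R *ᵥ (A *ᵥ w) = 0 := by
    intro w hw
    refine dotProduct_eq_zero _ fun z => ?_
    rw [dotProduct_comm]
    refine linear_coeff_eq_zero (b := z ⬝ᵥ (R *ᵥ (A *ᵥ z))) fun t => ?_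
    have h1 := hA (w + t • z)
    have h2 : ∀ y, w ⬝ᵥ (R *ᵥ y) = 0 := fun y => by
      rw [hR.dotProduct_mulVec_comm, hw, dotProduct_zero]
    simp only [Matrix.mulVec_add, Matrix.mulVec_smul, add_dotProduct, dotProduct_add,
      smul_dotProduct, dotProduct_smul, smul_eq_mul, h2] at h1
    linarith
  have hB : ∀ v, R *ᵥ (B *ᵥ v) = 0 := by
    intro v
    refine dotProduct_eq_zero _ fun x => ?_
    rw [dotProduct_comm]
    refine linear_coeff_eq_zero (b := x ⬝ᵥ (R *ᵥ (A *ᵥ x))) fun t => ?_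
    have h1 := h (t • x) v
    simp only [Matrix.mulVec_add, Matrix.mulVec_smul, dotProduct_add,
      smul_dotProduct, dotProduct_smul, smul_eq_mul] at h1
    linarith
  refine hAB.eq_zero_of_mul_eq_zero fun k => ?_
  have hk : ∀ k : ℕ, ∀ v, R *ᵥ ((A ^ k * B) *ᵥ v) = 0 := by
    intro k
    induction k with
    | zero => simpa using hB
    | succ k ih =>
      intro v
      rw [pow_succ', Matrix.mul_assoc, ← Matrix.mulVec_mulVec]
      exact hinv _ (ih v)
  rw [← Matrix.mulVec_injective.eq_iff]
  funext v
  rw [← Matrix.mulVec_mulVec, hk]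
  simp

/-- A polyhedral set, possibly with infinitely many faces, whose recession cone is trivial is
compact. -/
theorem isCompact_of_recession {V ι : Type*} [NormedAddCommGroup V] [NormedSpace ℝ V]
    [FiniteDimensional ℝ V] (l : ι → V →ₗ[ℝ] ℝ) (c : ι → ℝ)
    (h : ∀ R, (∀ i, l i R ≤ 0) → R = 0) : IsCompact {P | ∀ i, l i P ≤ c i} := by
  have : ProperSpace V := FiniteDimensional.proper ℝ V
  have hc : ∀ i, Continuous (l i) := fun i => (l i).continuous_of_finiteDimensional
  refine Metric.isCompact_of_isClosed_isBounded ?_ ?_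
  · rw [Set.ofPred_forall]
    exact isClosed_iInter fun i => isClosed_le (hc i) continuous_const
  · by_contra hunb
    have hex : ∀ k : ℕ, ∃ P, (∀ i, l i P ≤ c i) ∧ (k : ℝ) + 1 ≤ ‖P‖ := by
      intro k
      by_contra! hk
      exact hunb (isBounded_iff_forall_norm_le.mpr ⟨k + 1, fun P hP => (hk P hP).le⟩)
    choose P hP hPn using hex
    have hpos : ∀ k, 0 < ‖P k‖ := fun k => by
      linarith [hPn k, (Nat.cast_nonneg k : (0 : ℝ) ≤ k)]
    have hsph : ∀ k, ‖P k‖⁻¹ • P k ∈ Metric.sphere (0 : V) 1 := by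
      intro k
      rw [mem_sphere_zero_iff_norm, norm_smul, norm_inv, norm_norm, inv_mul_cancel₀ (hpos k).ne']
    obtain ⟨R, hR, φ, hφ, hlim⟩ := (isCompact_sphere (0 : V) 1).tendsto_subseq hsph
    have hR0 : R = 0 := by
      refine h R fun i => ?_
      have hinv : Filter.Tendsto (fun k => ‖P (φ k)‖⁻¹ * c i) Filter.atTop (nhds (0 * c i)) := by
        refine Filter.Tendsto.mul_const _ (tendsto_inv_atTop_zero.comp ?_)
        refine Filter.tendsto_atTop_mono (fun k => ?_) tendsto_natCast_atTop_atTop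
        have h1 : (k : ℝ) ≤ φ k := by exact_mod_cast hφ.id_le k
        linarith [hPn (φ k)]
      rw [zero_mul] at hinv
      refine le_of_tendsto_of_tendsto' (((hc i).tendsto R).comp hlim) hinv fun k => ?_
      simp only [Function.comp, map_smul, smul_eq_mul]
      exact mul_le_mul_of_nonneg_left (hP _ i) (inv_nonneg.mpr (norm_nonneg _))
    rw [hR0, mem_sphere_zero_iff_norm, norm_zero] at hR
    exact zero_ne_one hR

theorem exists_quadratic_of_strict_dissipation_sum {n p : Type*} [Fintype n] [Fintype p]
    [DecidableEq n] [DecidableEq p] {A : Matrix n n ℝ} {B : Matrix n p ℝ} {C : Matrix p n ℝ}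
    {D : Matrix p p ℝ} {S : (n → ℝ) → ℝ} (hS : ContDiff ℝ 1 S) (ε : ℝ)
    (h : ∀ x v, (x ≠ 0 ∨ v ≠ 0) → fderiv ℝ S x (A *ᵥ x + B *ᵥ v) <
      v ⬝ᵥ (C *ᵥ x + D *ᵥ v) + ε * (x ⬝ᵥ x + v ⬝ᵥ v)) :
    ∃ P : Matrix n n ℝ, P.IsSymm ∧ ∀ x v, (x ≠ 0 ∨ v ≠ 0) →
      x ⬝ᵥ (P *ᵥ (A *ᵥ x + B *ᵥ v)) < v ⬝ᵥ (C *ᵥ x + D *ᵥ v) + ε * (x ⬝ᵥ x + v ⬝ᵥ v) := by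
  let X : Matrix n (n ⊕ p) ℝ := Matrix.fromCols 1 0
  let F : Matrix n (n ⊕ p) ℝ := Matrix.fromCols A B
  let Q : Matrix (n ⊕ p) (n ⊕ p) ℝ := Matrix.fromBlocks (ε • 1) 0 C (D + ε • 1)
  have hX : ∀ x v, X *ᵥ (Sum.elim x v) = x := by
    intro x v
    simp [X]
  have hF : ∀ x v, F *ᵥ (Sum.elim x v) = A *ᵥ x + B *ᵥ v := by
    intro x v
    simp [F]
  have hQ : ∀ x v, (Sum.elim x v) ⬝ᵥ (Q *ᵥ (Sum.elim x v)) =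
      v ⬝ᵥ (C *ᵥ x + D *ᵥ v) + ε * (x ⬝ᵥ x + v ⬝ᵥ v) := by
    intro x v
    simp only [Q, Matrix.fromBlocks_mulVec, Sum.elim_comp_inl, Sum.elim_comp_inr,
      sumElim_dotProduct_sumElim, Matrix.smul_mulVec, Matrix.add_mulVec, Matrix.one_mulVec,
      Matrix.zero_mulVec, dotProduct_add, dotProduct_smul, smul_eq_mul, add_zero]
    ring
  have hne : ∀ x v, (x ≠ 0 ∨ v ≠ 0) ↔ (Sum.elim x v : n ⊕ p → ℝ) ≠ 0 := by
    intro x v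
    rw [← not_and_or, not_iff_not]
    constructor
    · rintro ⟨rfl, rfl⟩
      ext (i | i) <;> rfl
    · intro h0
      exact ⟨funext fun i => congrFun h0 (Sum.inl i), funext fun i => congrFun h0 (Sum.inr i)⟩
  obtain ⟨P, hP, hPQ⟩ := exists_quadratic_of_strict_dissipation X F Q hS (fun e he => by
    obtain ⟨x, v, rfl⟩ : ∃ x v, e = Sum.elim x v :=
      ⟨e ∘ Sum.inl, e ∘ Sum.inr, (Sum.elim_comp_inl_inr e).symm⟩
    rw [hX, hF, hQ]
    exact h x v ((hne x v).mpr he))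
  refine ⟨P, hP, fun x v hxv => ?_⟩
  have := hPQ _ ((hne x v).mp hxv)
  rwa [hX, hF, hQ] at this

open scoped Matrix.Norms.Elementwise in
/-- A controllable system with a `C¹` storage function has a quadratic one: perturb the supply rate
by `ε (|x|² + |v|²)` and let `ε → 0`; controllability keeps the solutions bounded. -/
theorem IsControllable.exists_quadratic_of_dissipation {n p : ℕ} {A : Matrix (Fin n) (Fin n) ℝ}
    {B : Matrix (Fin n) (Fin p) ℝ} {C : Matrix (Fin p) (Fin n) ℝ} {D : Matrix (Fin p) (Fin p) ℝ}
    (hAB : IsControllable A B) {S : (Fin n → ℝ) → ℝ} (hS : ContDiff ℝ 1 S)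
    (h : ∀ x v, fderiv ℝ S x (A *ᵥ x + B *ᵥ v) ≤ v ⬝ᵥ (C *ᵥ x + D *ᵥ v)) :
    ∃ P : Matrix (Fin n) (Fin n) ℝ, P.IsSymm ∧
      ∀ x v, x ⬝ᵥ (P *ᵥ (A *ᵥ x + B *ᵥ v)) ≤ v ⬝ᵥ (C *ᵥ x + D *ᵥ v) := by
  -- the linear constraints on `P`: the dissipation inequalities, and symmetry
  let l : ((Fin n → ℝ) × (Fin p → ℝ)) ⊕ (Fin n × Fin n) →
      Matrix (Fin n) (Fin n) ℝ →ₗ[ℝ] ℝ := Sum.elim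
    (fun z => { toFun := fun P => z.1 ⬝ᵥ (P *ᵥ (A *ᵥ z.1 + B *ᵥ z.2))
                map_add' := fun P P' => by simp only [Matrix.add_mulVec, dotProduct_add]
                map_smul' := fun r P => by
                  simp only [Matrix.smul_mulVec, dotProduct_smul, RingHom.id_apply] })
    (fun ij => Matrix.entryLinearMap ℝ ℝ ij.1 ij.2 - Matrix.entryLinearMap ℝ ℝ ij.2 ij.1)
  let c : ℕ → ((Fin n → ℝ) × (Fin p → ℝ)) ⊕ (Fin n × Fin n) → ℝ := fun k => Sum.elim
    (fun z => z.2 ⬝ᵥ (C *ᵥ z.1 + D *ᵥ z.2) + 1 / ((k : ℝ) + 1) * (z.1 ⬝ᵥ z.1 + z.2 ⬝ᵥ z.2))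
    (fun _ => 0)
  have hsymm : ∀ P : Matrix (Fin n) (Fin n) ℝ,
      (∀ ij : Fin n × Fin n, l (Sum.inr ij) P ≤ 0) → P.IsSymm := by
    intro P hP
    ext i j
    have h1 := hP (i, j)
    have h2 := hP (j, i)
    simp only [l, Sum.elim_inr, LinearMap.sub_apply, Matrix.entryLinearMap_apply] at h1 h2
    simp only [Matrix.transpose_apply]
    linarith
  have hcomp : ∀ k, IsCompact {P | ∀ i, l i P ≤ c k i} := fun k =>
    isCompact_of_recession l (c k) fun R hR =>
      hAB.eq_zero_of_dissipation (hsymm R fun ij => hR _) fun x v => hR (Sum.inl (x, v))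
  have hnn : ∀ (x : Fin n → ℝ) (v : Fin p → ℝ), 0 ≤ x ⬝ᵥ x + v ⬝ᵥ v := fun x v =>
    add_nonneg (Finset.sum_nonneg fun i _ => mul_self_nonneg (x i))
      (Finset.sum_nonneg fun i _ => mul_self_nonneg (v i))
  have hne : ∀ k, {P | ∀ i, l i P ≤ c k i}.Nonempty := by
    intro k
    have hk : (0 : ℝ) < 1 / ((k : ℝ) + 1) := by positivity
    obtain ⟨P, hP, hPd⟩ := exists_quadratic_of_strict_dissipation_sum (A := A) (B := B) (C := C)
      (D := D) hS (1 / ((k : ℝ) + 1)) (fun x v hxv => by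
        have h1 : 0 < x ⬝ᵥ x + v ⬝ᵥ v := by
          rcases hxv with hx | hv
          · have := hnn 0 v
            rw [dotProduct_zero] at this
            linarith [dotProduct_self_pos hx]
          · have := hnn x 0
            rw [dotProduct_zero] at this
            linarith [dotProduct_self_pos hv]
        linarith [h x v, mul_pos hk h1])
    refine ⟨P, ?_⟩
    rintro (⟨x, v⟩ | ⟨i, j⟩)
    · by_cases hxv : x ≠ 0 ∨ v ≠ 0
      · exact (hPd x v hxv).le
      · push Not at hxv
        obtain ⟨rfl, rfl⟩ := hxv
        simp [l, c]
    · simp [l, c, hP.apply i j]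
  obtain ⟨P, hP⟩ := IsCompact.nonempty_iInter_of_sequence_nonempty_isCompact_isClosed
    (fun k => {P | ∀ i, l i P ≤ c k i})
    (fun k P hP i => (hP i).trans (by
      rcases i with ⟨x, v⟩ | ij
      · simp only [c, Sum.elim_inl]
        gcongr
        · exact hnn x v
        · simp
      · exact le_rfl)) hne (hcomp 0) (fun k => (hcomp k).isClosed)
  rw [Set.mem_iInter] at hP
  refine ⟨P, hsymm P fun ij => hP 0 (Sum.inr ij), fun x v => ?_⟩
  have hlim : Filter.Tendsto (fun k : ℕ => v ⬝ᵥ (C *ᵥ x + D *ᵥ v) +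
      1 / ((k : ℝ) + 1) * (x ⬝ᵥ x + v ⬝ᵥ v)) Filter.atTop
      (nhds (v ⬝ᵥ (C *ᵥ x + D *ᵥ v) + 0 * (x ⬝ᵥ x + v ⬝ᵥ v))) :=
    (tendsto_one_div_add_atTop_nhds_zero_nat.mul_const _).const_add _
  rw [zero_mul, add_zero] at hlim
  exact ge_of_tendsto' hlim fun k => hP k (Sum.inl (x, v))

/-! ### Positive definiteness for observable systems -/

theorem contDiff_quadratic {n : Type*} [Fintype n] (P : Matrix n n ℝ) :
    ContDiff ℝ 1 fun x : n → ℝ => (1 / 2 : ℝ) * (x ⬝ᵥ (P *ᵥ x)) := by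
  simp only [dotProduct, Matrix.mulVec]
  fun_prop

theorem fderiv_quadratic {n : Type*} [Fintype n] {P : Matrix n n ℝ} (hP : P.IsSymm)
    (x y : n → ℝ) :
    fderiv ℝ (fun x : n → ℝ => (1 / 2 : ℝ) * (x ⬝ᵥ (P *ᵥ x))) x y = x ⬝ᵥ (P *ᵥ y) := by
  have h1 := ((contDiff_quadratic P).differentiable one_ne_zero x).hasFDerivAt.hasLineDerivAt y
  have h2 : HasDerivAt (fun t : ℝ => (1 / 2 : ℝ) * (x ⬝ᵥ (P *ᵥ x)) + t * (x ⬝ᵥ (P *ᵥ y)) +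
      t ^ 2 * ((1 / 2 : ℝ) * (y ⬝ᵥ (P *ᵥ y)))) (x ⬝ᵥ (P *ᵥ y)) 0 := by
    have h3 := (((hasDerivAt_id' (0 : ℝ)).mul_const (x ⬝ᵥ (P *ᵥ y))).const_add
      ((1 / 2 : ℝ) * (x ⬝ᵥ (P *ᵥ x)))).fun_add
      (((hasDerivAt_id' (0 : ℝ)).fun_pow 2).mul_const ((1 / 2 : ℝ) * (y ⬝ᵥ (P *ᵥ y))))
    exact h3.congr_deriv (by simp)
  refine HasDerivAt.unique h1 (h2.congr_of_eventuallyEq (Filter.Eventually.of_forall fun t => ?_))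
  simp only [Matrix.mulVec_add, Matrix.mulVec_smul, add_dotProduct, dotProduct_add,
    smul_dotProduct, dotProduct_smul, smul_eq_mul, hP.dotProduct_mulVec_comm y x]
  ring

/-- For the time-one map `T` of an observable system: a function that decreases along trajectories
at rate at least `|C x|²` decreases over unit time by at least the output energy, and this energy, a
positive definite quadratic form in the initial state, dominates a multiple of `|x|²`. -/
theorem exists_time_one_map {n p : Type*} [Fintype n] [DecidableEq n] [Fintype p]
    {A : Matrix n n ℝ} {C : Matrix p n ℝ}
    (hobs : ∀ x, (∀ k : ℕ, C *ᵥ (A ^ k *ᵥ x) = 0) → x = 0) :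
    ∃ (T : (n → ℝ) → n → ℝ) (c : ℝ), 0 < c ∧ ∀ f : (n → ℝ) → ℝ, ContDiff ℝ 1 f →
      (∀ x, fderiv ℝ f x (A *ᵥ x) ≤ -((C *ᵥ x) ⬝ᵥ (C *ᵥ x))) →
      ∀ x, f (T x) ≤ f x - c * (x ⬝ᵥ x) := by
  obtain ⟨E, hE0, hE, -⟩ := exists_linear_flow A
  have hEc : Continuous E := by
    refine continuous_matrix fun i j => ?_
    have h1 : Continuous fun t => E t *ᵥ Pi.single j 1 :=
      continuous_iff_continuousAt.mpr fun t => (hE t _).continuousAt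
    have h2 : ∀ t, E t i j = (E t *ᵥ Pi.single j 1) i := fun t => by simp
    simp_rw [h2]
    exact (continuous_apply i).comp h1
  let g : (n → ℝ) → ℝ → ℝ := fun x t => (C *ᵥ (E t *ᵥ x)) ⬝ᵥ (C *ᵥ (E t *ᵥ x))
  have hgc : Continuous (Function.uncurry g) := by
    simp only [g, Function.uncurry_def]
    fun_prop
  have hgx : ∀ x, Continuous (g x) := fun x => by
    simp only [g]
    fun_prop
  have hg0 : ∀ x t, 0 ≤ g x t := fun x t => Finset.sum_nonneg fun i _ => mul_self_nonneg _
  have hpos : ∀ x, x ≠ 0 → 0 < ∫ t in (0 : ℝ)..1, g x t := by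
    intro x hx
    refine intervalIntegral.integral_pos one_pos (hgx x).continuousOn (fun t _ => hg0 x t) ?_
    by_contra! hle
    -- differentiate the identity `C E(t) x = 0` repeatedly
    have hk : ∀ k : ℕ, ∀ t ∈ Set.Icc (0 : ℝ) 1, (C * A ^ k) *ᵥ (E t *ᵥ x) = 0 := by
      intro k
      induction k with
      | zero =>
        intro t ht
        rw [pow_zero, Matrix.mul_one]
        exact dotProduct_self_eq_zero.mp ((hle t ht).antisymm (hg0 x t))
      | succ k ih =>
        intro t ht
        have h1 : HasDerivAt (fun s => (C * A ^ k) *ᵥ (E s *ᵥ x))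
            ((C * A ^ k) *ᵥ (A *ᵥ (E t *ᵥ x))) t :=
          (LinearMap.toContinuousLinearMap
            (Matrix.mulVecLin (C * A ^ k))).hasFDerivAt.comp_hasDerivAt t (hE t x)
        have h2 := (hasDerivWithinAt_const t (Set.Icc (0 : ℝ) 1) (0 : p → ℝ)).congr
          (fun s hs => ih s hs) (ih t ht)
        have h3 := (uniqueDiffOn_Icc (zero_lt_one' ℝ) t ht).eq_deriv _ h1.hasDerivWithinAt h2
        rwa [Matrix.mulVec_mulVec, Matrix.mul_assoc, ← pow_succ] at h3
    refine hx (hobs x fun k => ?_)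
    have := hk k 0 (by simp)
    rwa [hE0, Matrix.one_mulVec, ← Matrix.mulVec_mulVec] at this
  obtain ⟨c, hc, hcg⟩ := exists_mul_dotProduct_self_le
    (g := fun x => ∫ t in (0 : ℝ)..1, g x t)
    (intervalIntegral.continuous_parametric_intervalIntegral_of_continuous' hgc 0 1)
    (fun r x => by
      rw [← intervalIntegral.integral_const_mul]
      congr 1
      ext t
      simp only [g, Matrix.mulVec_smul, smul_dotProduct, dotProduct_smul, smul_eq_mul]
      ring) hpos
  refine ⟨fun x => E 1 *ᵥ x, c, hc, fun f hf hfd x => ?_⟩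
  have hder : ∀ t, HasDerivAt (fun t => f (E t *ᵥ x) + ∫ s in (0 : ℝ)..t, g x s)
      (fderiv ℝ f (E t *ᵥ x) (A *ᵥ (E t *ᵥ x)) + g x t) t := by
    intro t
    exact (((hf.differentiable one_ne_zero) _).hasFDerivAt.comp_hasDerivAt t (hE t x)).add
      (intervalIntegral.integral_hasDerivAt_right ((hgx x).intervalIntegrable _ _)
        ((hgx x).stronglyMeasurableAtFilter _ _) (hgx x).continuousAt)
  have hanti : Antitone (fun t => f (E t *ᵥ x) + ∫ s in (0 : ℝ)..t, g x s) :=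
    antitone_of_deriv_nonpos (fun t => (hder t).differentiableAt) fun t => by
      rw [(hder t).deriv]
      linarith [hfd (E t *ᵥ x)]
  have h1 := hanti (zero_le_one' ℝ)
  simp only [hE0, Matrix.one_mulVec, intervalIntegral.integral_same, add_zero] at h1
  linarith [hcg x]

/-- An observable autonomous system with two functions `S` and `x ⬝ᵥ P *ᵥ x / 2` both decreasing
at rate at least `|C x|²`: nonnegativity of `S` makes every trajectory converge to the origin, and
then the quadratic function, strictly decreasing to `0`, must be positive. -/
theorem posDef_of_observable_of_decreasing {n p : Type*} [Fintype n] [DecidableEq n] [Fintype p]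
    {A : Matrix n n ℝ} {C : Matrix p n ℝ}
    (hobs : ∀ x, (∀ k : ℕ, C *ᵥ (A ^ k *ᵥ x) = 0) → x = 0)
    {S : (n → ℝ) → ℝ} (hS : ContDiff ℝ 1 S) (hS0 : ∀ x, 0 ≤ S x)
    (hSd : ∀ x, fderiv ℝ S x (A *ᵥ x) ≤ -((C *ᵥ x) ⬝ᵥ (C *ᵥ x)))
    {P : Matrix n n ℝ} (hP : P.IsSymm)
    (hPd : ∀ x, x ⬝ᵥ (P *ᵥ (A *ᵥ x)) ≤ -((C *ᵥ x) ⬝ᵥ (C *ᵥ x))) : P.PosDef := by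
  obtain ⟨T, c, hc, hT⟩ := exists_time_one_map hobs
  let V : (n → ℝ) → ℝ := fun x => (1 / 2 : ℝ) * (x ⬝ᵥ (P *ᵥ x))
  have hTS := hT S hS hSd
  have hTV : ∀ x, V (T x) ≤ V x - c * (x ⬝ᵥ x) :=
    hT V (contDiff_quadratic P) fun x => by rw [fderiv_quadratic hP]; exact hPd x
  have hnn : ∀ x : n → ℝ, 0 ≤ x ⬝ᵥ x := fun x =>
    Finset.sum_nonneg fun i _ => mul_self_nonneg (x i)
  refine Matrix.PosDef.of_dotProduct_mulVec_pos
    (by simpa [Matrix.IsHermitian] using hP.eq) fun x hx => ?_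
  rw [star_trivial]
  by_contra! hneg
  let z : ℕ → n → ℝ := fun k => T^[k] x
  have hz : ∀ k, z (k + 1) = T (z k) := fun k => Function.iterate_succ_apply' T k x
  -- the total decrease of `S` along the sampled trajectory is finite
  have hsum : ∀ N, ∑ k ∈ Finset.range N, c * (z k ⬝ᵥ z k) ≤ S x - S (z N) := by
    intro N
    induction N with
    | zero => simp [z]
    | succ N ih =>
      rw [Finset.sum_range_succ, hz]
      linarith [hTS (z N)]
  have hlim : Filter.Tendsto (fun k => c * (z k ⬝ᵥ z k)) Filter.atTop (nhds 0) :=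
    (summable_of_sum_range_le (fun k => mul_nonneg hc.le (hnn _))
      fun N => (hsum N).trans (sub_le_self _ (hS0 _))).tendsto_atTop_zero
  have hz0 : Filter.Tendsto z Filter.atTop (nhds 0) := by
    rw [tendsto_pi_nhds]
    intro i
    have h1 : Filter.Tendsto (fun k => √(c⁻¹ * (c * (z k ⬝ᵥ z k)))) Filter.atTop (nhds 0) := by
      simpa using (hlim.const_mul c⁻¹).sqrt
    refine squeeze_zero_norm (fun k => ?_) h1
    rw [inv_mul_cancel_left₀ hc.ne', Real.norm_eq_abs]
    refine Real.abs_le_sqrt ?_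
    rw [sq]
    exact Finset.single_le_sum (f := fun j => z k j * z k j)
      (fun j _ => mul_self_nonneg _) (Finset.mem_univ i)
  have hVlim : Filter.Tendsto (fun k => V (z (k + 1))) Filter.atTop (nhds (V 0)) :=
    (((contDiff_quadratic P).continuous.tendsto 0).comp hz0).comp (Filter.tendsto_add_atTop_nat 1)
  have hVle : ∀ k, V (z (k + 1)) ≤ -(c * (x ⬝ᵥ x)) := by
    intro k
    induction k with
    | zero =>
      have h1 := hTV x
      rw [hz]
      change V (T x) ≤ _
      have h2 : V x ≤ 0 := by simp only [V]; linarith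
      linarith
    | succ k ih =>
      rw [hz]
      linarith [hTV (z (k + 1)), mul_nonneg hc.le (hnn (z (k + 1)))]
  have h1 := le_of_tendsto' hVlim hVle
  have h2 : V 0 = 0 := by simp [V]
  linarith [mul_pos hc (dotProduct_self_pos hx)]

/-- Every symmetric solution of the dissipation inequality is positive definite, provided the system
is observable and has a nonnegative storage function: apply the output feedback `v = -z`, under
which the supply rate is `-|z|²`, and observability is preserved. -/
theorem IsObservable.posDef_of_dissipation {n p : ℕ} {A : Matrix (Fin n) (Fin n) ℝ}
    {B : Matrix (Fin n) (Fin p) ℝ} {C : Matrix (Fin p) (Fin n) ℝ} {D : Matrix (Fin p) (Fin p) ℝ}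
    (hAC : IsObservable A C) {S : (Fin n → ℝ) → ℝ} (hS : ContDiff ℝ 1 S) (hS0 : ∀ x, 0 ≤ S x)
    (hSd : ∀ x v, fderiv ℝ S x (A *ᵥ x + B *ᵥ v) ≤ v ⬝ᵥ (C *ᵥ x + D *ᵥ v))
    {P : Matrix (Fin n) (Fin n) ℝ} (hP : P.IsSymm)
    (hPd : ∀ x v, x ⬝ᵥ (P *ᵥ (A *ᵥ x + B *ᵥ v)) ≤ v ⬝ᵥ (C *ᵥ x + D *ᵥ v)) : P.PosDef := by
  have hD : ∀ v, 0 ≤ v ⬝ᵥ (D *ᵥ v) := fun v => by simpa using hPd 0 v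
  have hu : IsUnit (1 + D) := by
    rw [← Matrix.mulVec_injective_iff_isUnit]
    intro v w hvw
    have h1 : (1 + D) *ᵥ (v - w) = 0 := by rw [Matrix.mulVec_sub, hvw, sub_self]
    have h2 : (v - w) ⬝ᵥ (v - w) + (v - w) ⬝ᵥ (D *ᵥ (v - w)) = 0 := by
      rw [← dotProduct_add]
      nth_rewrite 2 [← Matrix.one_mulVec (v - w)]
      rw [← Matrix.add_mulVec, h1, dotProduct_zero]
    by_contra hne
    linarith [hD (v - w), dotProduct_self_pos (sub_ne_zero.mpr hne)]
  have hJ : (1 + D) * (1 + D)⁻¹ = 1 :=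
    Matrix.mul_nonsing_inv _ ((Matrix.isUnit_iff_isUnit_det _).mp hu)
  set J := (1 + D)⁻¹
  -- the feedback `v = -J C x` realizes `v = -z`
  have hx : ∀ x, A *ᵥ x + B *ᵥ (-((J * C) *ᵥ x)) = (A - B * (J * C)) *ᵥ x := by
    intro x
    rw [Matrix.mulVec_neg, Matrix.mulVec_mulVec, Matrix.sub_mulVec, sub_eq_add_neg]
  have hz : ∀ x, -((J * C) *ᵥ x) ⬝ᵥ (C *ᵥ x + D *ᵥ (-((J * C) *ᵥ x))) =
      -(((J * C) *ᵥ x) ⬝ᵥ ((J * C) *ᵥ x)) := by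
    intro x
    have h1 : C - D * (J * C) = J * C := by
      rw [sub_eq_iff_eq_add]
      calc C = (1 + D) * J * C := by rw [hJ, Matrix.one_mul]
        _ = _ := by rw [Matrix.mul_assoc, Matrix.add_mul, Matrix.one_mul]
    have h2 : C *ᵥ x + D *ᵥ (-((J * C) *ᵥ x)) = (J * C) *ᵥ x := by
      rw [Matrix.mulVec_neg, Matrix.mulVec_mulVec, ← sub_eq_add_neg, ← Matrix.sub_mulVec, h1]
    rw [h2, neg_dotProduct]
  refine posDef_of_observable_of_decreasing (A := A - B * (J * C)) (C := J * C) (fun x hk => ?_)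
    hS hS0 (fun x => ?_) hP (fun x => ?_)
  · have hC : ∀ k : ℕ, C *ᵥ ((A - B * (J * C)) ^ k *ᵥ x) = 0 := by
      intro k
      calc C *ᵥ ((A - B * (J * C)) ^ k *ᵥ x)
          = (1 + D) *ᵥ ((J * C) *ᵥ ((A - B * (J * C)) ^ k *ᵥ x)) := by
            rw [Matrix.mulVec_mulVec _ (1 + D), ← Matrix.mul_assoc (1 + D), hJ, Matrix.one_mul]
        _ = 0 := by rw [hk k, Matrix.mulVec_zero]
    have hA : ∀ k : ℕ, (A - B * (J * C)) ^ k *ᵥ x = A ^ k *ᵥ x := by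
      intro k
      induction k with
      | zero => simp
      | succ k ih =>
        rw [pow_succ', pow_succ', ← Matrix.mulVec_mulVec, ← Matrix.mulVec_mulVec, Matrix.sub_mulVec,
          ← Matrix.mulVec_mulVec _ B, hk k, Matrix.mulVec_zero, sub_zero, ih]
    exact hAC.eq_zero_of_mulVec_eq_zero fun k => by rw [← hA]; exact hC k
  · rw [← hx, ← hz]
    exact hSd x _
  · rw [← hx, ← hz]
    exact hPd x _

/-! ### Strict dissipation without feedthrough -/

theorem slope_eq_zero {a b : ℝ} (h : ∀ t : ℝ, t * a + b ≤ 0) : a = 0 := by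
  by_contra ha
  have := h ((1 - b) / a)
  rw [div_mul_cancel₀ _ ha] at this
  linarith

/-- Without feedthrough, a storage function satisfies `∇S(x) ⬝ B v = v ⬝ C x`, which determines it
along `im B`: with `Π = 1 - B G C` a projection along `im B`, it is the sum of `S ∘ Π` and the
quadratic form of `Cᵀ G C / 2`. -/
theorem fderiv_eq_fderiv_comp_add {n p : Type*} [Fintype n] [DecidableEq n] [Fintype p]
    {B : Matrix n p ℝ} {C : Matrix p n ℝ} {G : Matrix p p ℝ} (hG : G.IsSymm)
    (hCB : C * B * G * C = C) {S : (n → ℝ) → ℝ} (hS : ContDiff ℝ 1 S)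
    (hSB : ∀ x v, fderiv ℝ S x (B *ᵥ v) = v ⬝ᵥ (C *ᵥ x)) (x y : n → ℝ) :
    fderiv ℝ S x y = fderiv ℝ S ((1 - B * G * C) *ᵥ x) ((1 - B * G * C) *ᵥ y) +
      x ⬝ᵥ ((Cᵀ * G * C) *ᵥ y) := by
  have hd := hS.differentiable one_ne_zero
  have hCP : C * (1 - B * G * C) = 0 := by
    rw [Matrix.mul_sub, Matrix.mul_one, ← Matrix.mul_assoc, ← Matrix.mul_assoc, hCB, sub_self]
  have hsymm : (Cᵀ * G * C).IsSymm := by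
    simp [Matrix.IsSymm, Matrix.transpose_mul, hG.eq, Matrix.mul_assoc]
  have hval : S = fun x => S ((1 - B * G * C) *ᵥ x) +
      (1 / 2 : ℝ) * (x ⬝ᵥ ((Cᵀ * G * C) *ᵥ x)) := by
    funext x
    set w := (G * C) *ᵥ x with hw
    set z := (1 - B * G * C) *ᵥ x with hz
    set q := x ⬝ᵥ ((Cᵀ * G * C) *ᵥ x) with hq
    have hxz : z + B *ᵥ w = x := by
      rw [hz, hw, Matrix.mulVec_mulVec, ← Matrix.add_mulVec, ← Matrix.mul_assoc, sub_add_cancel,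
        Matrix.one_mulVec]
    have hCz : C *ᵥ z = 0 := by rw [hz, Matrix.mulVec_mulVec, hCP, Matrix.zero_mulVec]
    have hwq : w ⬝ᵥ (C *ᵥ (B *ᵥ w)) = q := by
      have h1 : C *ᵥ (B *ᵥ w) = C *ᵥ x := by
        conv_rhs => rw [← hxz, Matrix.mulVec_add, hCz, zero_add]
      rw [h1, hw, hq, ← Matrix.mulVec_mulVec, ← Matrix.mulVec_mulVec, ← Matrix.mulVec_mulVec,
        Matrix.dotProduct_mulVec x Cᵀ, Matrix.vecMul_transpose, dotProduct_comm]
    have hder : ∀ t : ℝ, HasDerivAt (fun t : ℝ => S (z + t • (B *ᵥ w)) - t ^ 2 * (q / 2)) 0 t := by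
      intro t
      have h1 : HasDerivAt (fun t : ℝ => z + t • (B *ᵥ w)) (B *ᵥ w) t := by
        simpa using ((hasDerivAt_id' t).smul_const (B *ᵥ w)).const_add z
      have h2 := ((hd _).hasFDerivAt.comp_hasDerivAt t h1).fun_sub
        (((hasDerivAt_id' t).fun_pow 2).mul_const (q / 2))
      refine h2.congr_deriv ?_
      rw [hSB, Matrix.mulVec_add, hCz, Matrix.mulVec_smul, zero_add, dotProduct_smul, hwq,
        smul_eq_mul]
      simp
      ring
    have hconst := is_const_of_deriv_eq_zero (fun t => (hder t).differentiableAt)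
      (fun t => (hder t).deriv) 1 0
    simp only [one_smul, zero_smul, add_zero, hxz] at hconst
    linarith
  have h1 : HasFDerivAt (fun x => S ((1 - B * G * C) *ᵥ x))
      ((fderiv ℝ S ((1 - B * G * C) *ᵥ x)).comp
        (LinearMap.toContinuousLinearMap (Matrix.mulVecLin (1 - B * G * C)))) x :=
    (hd _).hasFDerivAt.comp x
      (LinearMap.toContinuousLinearMap (Matrix.mulVecLin (1 - B * G * C))).hasFDerivAt
  have h2 := h1.fun_add
    ((contDiff_quadratic (Cᵀ * G * C)).differentiable one_ne_zero x).hasFDerivAt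
  rw [← hval] at h2
  rw [h2.fderiv, add_apply, fderiv_quadratic hsymm]
  rfl

/-- The strict case without feedthrough. The constraint `P B = Cᵀ` is met by
`P = Πᵀ R Π + Cᵀ G C`, where `G` is an inner inverse of `C B` and `Π = 1 - B G C`; what remains is a
strict dissipation inequality for `R` on the whole state space. -/
theorem exists_quadratic_of_strict_of_no_feedthrough {n p : Type*} [Fintype n] [DecidableEq n]
    [Fintype p] [DecidableEq p] {A : Matrix n n ℝ} {B : Matrix n p ℝ} {C : Matrix p n ℝ}
    {P₀ : Matrix n n ℝ} (hP₀ : P₀.PosDef) (hPB : P₀ * B = Cᵀ) {S : (n → ℝ) → ℝ}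
    (hS : ContDiff ℝ 1 S) (hSB : ∀ x v, fderiv ℝ S x (B *ᵥ v) = v ⬝ᵥ (C *ᵥ x))
    (hSA : ∀ x, x ≠ 0 → fderiv ℝ S x (A *ᵥ x) < 0) :
    ∃ P : Matrix n n ℝ, P.IsSymm ∧ P * B = Cᵀ ∧ ∀ x, x ≠ 0 → x ⬝ᵥ (P *ᵥ (A *ᵥ x)) < 0 := by
  have hP₀s : P₀ᵀ = P₀ := by simpa [Matrix.IsHermitian] using hP₀.1
  have hC : C = Bᵀ * P₀ := by
    rw [← Matrix.transpose_transpose C, ← hPB, Matrix.transpose_mul, hP₀s]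
  have hHs : (C * B).IsSymm := by
    rw [hC]
    simp [Matrix.IsSymm, Matrix.transpose_mul, hP₀s, Matrix.mul_assoc]
  obtain ⟨G, hG, hHG⟩ := exists_isSymm_innerInverse hHs
  have hBG : B * (G * (C * B)) = B := by
    have h1 : (B * (G * (C * B)) - B)ᵀ * P₀ * (B * (G * (C * B)) - B) = 0 := by
      have h2 : Bᵀ * P₀ * (B * (G * (C * B)) - B) = 0 := by
        rw [← hC, Matrix.mul_sub, ← Matrix.mul_assoc, ← Matrix.mul_assoc, hHG, sub_self]
      have h3 : (B * (G * (C * B)) - B)ᵀ = (G * (C * B) - 1)ᵀ * Bᵀ := by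
        rw [← Matrix.transpose_mul, Matrix.mul_sub, Matrix.mul_one]
      rw [h3, Matrix.mul_assoc, Matrix.mul_assoc, ← Matrix.mul_assoc Bᵀ, h2, Matrix.mul_zero]
    set Y := B * (G * (C * B)) - B
    have hY : Y = 0 := by
      rw [← Matrix.mulVec_injective.eq_iff]
      funext v
      rw [Matrix.zero_mulVec]
      by_contra hne
      have h4 := hP₀.dotProduct_mulVec_pos hne
      rw [star_trivial, Matrix.mulVec_mulVec, ← Matrix.vecMul_transpose,
        ← Matrix.dotProduct_mulVec, Matrix.mulVec_mulVec, ← Matrix.mul_assoc, h1] at h4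
      simp at h4
    exact sub_eq_zero.mp hY
  have hCB : C * B * G * C = C := by
    have h1 : C * B * G * Bᵀ = Bᵀ := by
      have := congrArg Matrix.transpose hBG
      rw [Matrix.transpose_mul, Matrix.transpose_mul, hHs.eq, hG.eq] at this
      exact this
    nth_rewrite 2 [hC]
    rw [← Matrix.mul_assoc, h1, ← hC]
  set Pi := 1 - B * G * C with hPi
  have hPiB : Pi * B = 0 := by
    rw [hPi, Matrix.sub_mul, Matrix.one_mul, Matrix.mul_assoc, Matrix.mul_assoc, hBG, sub_self]
  obtain ⟨R, hR, hRd⟩ := exists_quadratic_of_strict_dissipation Pi (Pi * A) (-(Cᵀ * G * C * A)) hS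
    (fun e he => by
      have h1 := fderiv_eq_fderiv_comp_add hG hCB hS hSB e (A *ᵥ e)
      have h2 := hSA e he
      rw [Matrix.mulVec_mulVec, Matrix.mulVec_mulVec] at h1
      rw [Matrix.neg_mulVec, dotProduct_neg]
      linarith)
  refine ⟨Piᵀ * R * Pi + Cᵀ * G * C, ?_, ?_, fun x hx => ?_⟩
  · simp [Matrix.IsSymm, Matrix.transpose_mul, hG.eq, hR.eq, Matrix.mul_assoc]
  · rw [Matrix.add_mul, Matrix.mul_assoc _ Pi, hPiB, Matrix.mul_zero, zero_add]
    have := congrArg Matrix.transpose hCB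
    rw [Matrix.mul_assoc, Matrix.transpose_mul, hHs.eq, Matrix.transpose_mul, hG.eq] at this
    rw [Matrix.mul_assoc]
    exact this
  · have h1 := hRd x hx
    rw [Matrix.neg_mulVec, dotProduct_neg] at h1
    have h2 : x ⬝ᵥ ((Piᵀ * R * Pi) *ᵥ (A *ᵥ x)) = (Pi *ᵥ x) ⬝ᵥ (R *ᵥ ((Pi * A) *ᵥ x)) := by
      rw [Matrix.mul_assoc, ← Matrix.mulVec_mulVec, Matrix.dotProduct_mulVec x,
        Matrix.vecMul_transpose]
      simp only [Matrix.mulVec_mulVec, Matrix.mul_assoc]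
    rw [Matrix.add_mulVec, dotProduct_add, h2, Matrix.mulVec_mulVec x (Cᵀ * G * C)]
    linarith

/-! ### The matrix inequality as a dissipation inequality -/

theorem negS_iff {ι : Type*} [Fintype ι] {mode : PassivityMode} {X : Matrix ι ι ℝ}
    (hX : X.IsSymm) : NegS mode X ↔ (∀ ξ, ξ ⬝ᵥ (X *ᵥ ξ) ≤ 0) ∧
      (mode = .strict → ∀ ξ, ξ ≠ 0 → ξ ⬝ᵥ (X *ᵥ ξ) < 0) := by
  have hX' : (-X).IsHermitian := by
    simpa [Matrix.IsHermitian, Matrix.transpose_neg] using hX.eq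
  cases mode with
  | nonstrict =>
    simp only [NegS, Matrix.posSemidef_iff_dotProduct_mulVec, hX', true_and, star_trivial,
      Matrix.neg_mulVec, dotProduct_neg, Left.nonneg_neg_iff, reduceCtorEq, false_imp_iff, and_true]
  | strict =>
    simp only [NegS, Matrix.posDef_iff_dotProduct_mulVec, hX', true_and, star_trivial,
      Matrix.neg_mulVec, dotProduct_neg, Left.neg_pos_iff, forall_true_left]
    refine ⟨fun h => ⟨fun ξ => ?_, fun ξ hξ => h hξ⟩, fun h ξ hξ => h.2 ξ hξ⟩
    by_cases hξ : ξ = 0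
    · simp [hξ]
    · exact (h hξ).le

section LMI

variable {n m p : ℕ} {A : Matrix (Fin n) (Fin n) ℝ} {Bu : Matrix (Fin n) (Fin m) ℝ}
  {Bd : Matrix (Fin n) (Fin p) ℝ} {C : Matrix (Fin p) (Fin n) ℝ} {D : Matrix (Fin p) (Fin p) ℝ}
  {K : Matrix (Fin m) (Fin n) ℝ} {Z P : Matrix (Fin n) (Fin n) ℝ}

theorem N0_mul_eq (hZ : Z.IsSymm) :
    N0 A Bu Z (K * Z) = Z * (closedLoop A Bu K)ᵀ + closedLoop A Bu K * Z := by
  simp only [N0, closedLoop, Matrix.transpose_mul, Matrix.transpose_sub, Matrix.sub_mul,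
    Matrix.mul_sub, hZ.eq, Matrix.mul_assoc]
  abel

theorem isSymm_N0 (hZ : Z.IsSymm) : (N0 A Bu Z (K * Z)).IsSymm := by
  rw [N0_mul_eq hZ]
  simp [Matrix.IsSymm, Matrix.transpose_add, Matrix.transpose_mul, hZ.eq, add_comm]

theorem isSymm_ND (hZ : Z.IsSymm) : (ND A Bu Bd C D Z (K * Z)).IsSymm := by
  refine Matrix.IsSymm.fromBlocks (isSymm_N0 hZ) ?_ ?_
  · simp [Matrix.transpose_sub, Matrix.transpose_mul, hZ.eq]
  · simp only [Matrix.IsSymm, Matrix.transpose_sub, Matrix.transpose_neg,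
      Matrix.transpose_transpose]
    abel

theorem dotProduct_N0_mulVec (hZ : Z.IsSymm) (hP : P.IsSymm) (hZP : Z * P = 1) (x : Fin n → ℝ) :
    (P *ᵥ x) ⬝ᵥ (N0 A Bu Z (K * Z) *ᵥ (P *ᵥ x)) =
      2 * (x ⬝ᵥ (P *ᵥ (closedLoop A Bu K *ᵥ x))) := by
  have hZx : Z *ᵥ (P *ᵥ x) = x := by rw [Matrix.mulVec_mulVec, hZP, Matrix.one_mulVec]
  rw [N0_mul_eq hZ, Matrix.add_mulVec, dotProduct_add, ← Matrix.mulVec_mulVec,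
    ← Matrix.mulVec_mulVec, hZx, hZ.dotProduct_mulVec_comm, hZx, Matrix.mulVec_transpose,
    hP.dotProduct_mulVec_comm x, ← Matrix.dotProduct_mulVec, two_mul,
    dotProduct_comm (P *ᵥ x)]

/-- The congruence by `diag(P, 1)` turns the block matrix into the quadratic form of the dissipation
inequality for the storage function `x ⬝ᵥ P *ᵥ x / 2`. -/
theorem dotProduct_ND_mulVec (hZ : Z.IsSymm) (hP : P.IsSymm) (hZP : Z * P = 1) (x : Fin n → ℝ)
    (v : Fin p → ℝ) :
    (Sum.elim (P *ᵥ x) v) ⬝ᵥ (ND A Bu Bd C D Z (K * Z) *ᵥ (Sum.elim (P *ᵥ x) v)) =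
      2 * (x ⬝ᵥ (P *ᵥ (closedLoop A Bu K *ᵥ x + Bd *ᵥ v)) - v ⬝ᵥ (C *ᵥ x + D *ᵥ v)) := by
  have hZx : Z *ᵥ (P *ᵥ x) = x := by rw [Matrix.mulVec_mulVec, hZP, Matrix.one_mulVec]
  have h0 := dotProduct_N0_mulVec (A := A) (Bu := Bu) (K := K) hZ hP hZP x
  have h1 : (P *ᵥ x) ⬝ᵥ (Z *ᵥ (Cᵀ *ᵥ v)) = v ⬝ᵥ (C *ᵥ x) := by
    rw [hZ.dotProduct_mulVec_comm, hZx, Matrix.mulVec_transpose, Matrix.dotProduct_mulVec]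
  have h2 : v ⬝ᵥ (Bdᵀ *ᵥ (P *ᵥ x)) = x ⬝ᵥ (P *ᵥ (Bd *ᵥ v)) := by
    rw [hP.dotProduct_mulVec_comm x, Matrix.dotProduct_mulVec, Matrix.vecMul_transpose]
  have h3 : (P *ᵥ x) ⬝ᵥ (Bd *ᵥ v) = x ⬝ᵥ (P *ᵥ (Bd *ᵥ v)) := by
    rw [hP.dotProduct_mulVec_comm x, dotProduct_comm]
  have h4 : v ⬝ᵥ (Dᵀ *ᵥ v) = v ⬝ᵥ (D *ᵥ v) := by
    rw [Matrix.mulVec_transpose, dotProduct_comm, ← Matrix.dotProduct_mulVec]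
  change _ ⬝ᵥ (Matrix.fromBlocks (N0 A Bu Z (K * Z)) _ _ _ *ᵥ _) = _
  simp only [Matrix.fromBlocks_mulVec, Sum.elim_comp_inl, Sum.elim_comp_inr,
    sumElim_dotProduct_sumElim, dotProduct_add, h0, Matrix.sub_mulVec, Matrix.neg_mulVec,
    dotProduct_sub, dotProduct_neg, ← Matrix.mulVec_mulVec, hZx, h1, h2, h3, h4, Matrix.mulVec_add]
  ring

theorem negS_N0_iff {mode : PassivityMode} (hZ : Z.IsSymm) (hP : P.IsSymm) (hZP : Z * P = 1) :
    NegS mode (N0 A Bu Z (K * Z)) ↔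
      (∀ x, x ⬝ᵥ (P *ᵥ (closedLoop A Bu K *ᵥ x)) ≤ 0) ∧
      (mode = .strict → ∀ x, x ≠ 0 → x ⬝ᵥ (P *ᵥ (closedLoop A Bu K *ᵥ x)) < 0) := by
  have hPZ : P * Z = 1 := mul_eq_one_comm.mp hZP
  have hPx : ∀ ξ, P *ᵥ (Z *ᵥ ξ) = ξ := fun ξ => by
    rw [Matrix.mulVec_mulVec, hPZ, Matrix.one_mulVec]
  have hZx : ∀ ξ, Z *ᵥ (P *ᵥ ξ) = ξ := fun ξ => by
    rw [Matrix.mulVec_mulVec, hZP, Matrix.one_mulVec]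
  have key := dotProduct_N0_mulVec (A := A) (Bu := Bu) (K := K) hZ hP hZP
  rw [negS_iff (isSymm_N0 hZ)]
  constructor
  · rintro ⟨h, h'⟩
    refine ⟨fun x => by linarith [h (P *ᵥ x), key x], fun hm x hx => ?_⟩
    have := h' hm (P *ᵥ x) fun h0 => hx (by rw [← hZx x, h0, Matrix.mulVec_zero])
    linarith [key x]
  · rintro ⟨h, h'⟩
    refine ⟨fun ξ => ?_, fun hm ξ hξ => ?_⟩
    · rw [← hPx ξ, key]
      linarith [h (Z *ᵥ ξ)]
    · rw [← hPx ξ, key]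
      linarith [h' hm (Z *ᵥ ξ) fun h0 => hξ (by rw [← hPx ξ, h0, Matrix.mulVec_zero])]

theorem negS_ND_iff {mode : PassivityMode} (hZ : Z.IsSymm) (hP : P.IsSymm) (hZP : Z * P = 1) :
    NegS mode (ND A Bu Bd C D Z (K * Z)) ↔
      (∀ x v, x ⬝ᵥ (P *ᵥ (closedLoop A Bu K *ᵥ x + Bd *ᵥ v)) ≤ v ⬝ᵥ (C *ᵥ x + D *ᵥ v)) ∧
      (mode = .strict → ∀ x v, (x ≠ 0 ∨ v ≠ 0) →
        x ⬝ᵥ (P *ᵥ (closedLoop A Bu K *ᵥ x + Bd *ᵥ v)) < v ⬝ᵥ (C *ᵥ x + D *ᵥ v)) := by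
  have hPZ : P * Z = 1 := mul_eq_one_comm.mp hZP
  have hZx : ∀ ξ, Z *ᵥ (P *ᵥ ξ) = ξ := fun ξ => by
    rw [Matrix.mulVec_mulVec, hZP, Matrix.one_mulVec]
  have key := dotProduct_ND_mulVec (A := A) (Bu := Bu) (Bd := Bd) (C := C) (D := D) (K := K)
    hZ hP hZP
  have hex : ∀ ξ : Fin n ⊕ Fin p → ℝ, ∃ x v, ξ = Sum.elim (P *ᵥ x) v := by
    intro ξ
    refine ⟨Z *ᵥ (ξ ∘ Sum.inl), ξ ∘ Sum.inr, ?_⟩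
    rw [Matrix.mulVec_mulVec, hPZ, Matrix.one_mulVec, Sum.elim_comp_inl_inr]
  rw [negS_iff (isSymm_ND hZ)]
  constructor
  · rintro ⟨h, h'⟩
    refine ⟨fun x v => by linarith [h (Sum.elim (P *ᵥ x) v), key x v], fun hm x v hxv => ?_⟩
    have := h' hm (Sum.elim (P *ᵥ x) v) fun h0 => by
      rcases hxv with hx | hv
      · refine hx ?_
        have h1 : P *ᵥ x = 0 := funext fun i => congrFun h0 (Sum.inl i)
        rw [← hZx x, h1, Matrix.mulVec_zero]
      · exact hv (funext fun i => congrFun h0 (Sum.inr i))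
    linarith [key x v]
  · rintro ⟨h, h'⟩
    refine ⟨fun ξ => ?_, fun hm ξ hξ => ?_⟩ <;> obtain ⟨x, v, rfl⟩ := hex ξ <;> rw [key]
    · linarith [h x v]
    · have hxv : x ≠ 0 ∨ v ≠ 0 := by
        by_contra! h0
        obtain ⟨rfl, rfl⟩ := h0
        refine hξ (funext fun i => ?_)
        cases i <;> simp
      linarith [h' hm x v hxv]

theorem mul_eq_transpose_iff (hZ : Z.IsSymm) (hZP : Z * P = 1) : Bdᵀ = C * Z ↔ P * Bd = Cᵀ := by
  have hPZ : P * Z = 1 := mul_eq_one_comm.mp hZP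
  rw [← Matrix.transpose_inj, Matrix.transpose_transpose, Matrix.transpose_mul, hZ.eq]
  constructor
  · rintro rfl
    rw [← Matrix.mul_assoc, hPZ, Matrix.one_mul]
  · rintro h
    rw [← h, ← Matrix.mul_assoc, hZP, Matrix.one_mul]

theorem IsDissipationRate.nonneg {mode : PassivityMode} {ψ : (Fin n → ℝ) → ℝ}
    (h : IsDissipationRate mode ψ) (x : Fin n → ℝ) : 0 ≤ ψ x := by
  cases mode with
  | nonstrict => exact (h x).ge
  | strict =>
    by_cases hx : x = 0
    · rw [hx, h.1]
    · exact (h.2 x hx).le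

/-- A positive definite solution of the matrix inequality certifies passivity. -/
theorem SatisfiesLMI.isStorageFunction {mode : PassivityMode} (hZ : Z.PosDef)
    (h : SatisfiesLMI mode A Bu Bd C D Z (K * Z)) :
    IsStorageFunction mode (closedLoop A Bu K) Bd C D
      (fun x => (1 / 2 : ℝ) * (x ⬝ᵥ (Z⁻¹ *ᵥ x))) := by
  have hZs : Z.IsSymm := Matrix.isHermitian_iff_isSymm.mp hZ.1
  have hPd : (Z⁻¹).PosDef := hZ.inv
  have hPs : (Z⁻¹).IsSymm := Matrix.isHermitian_iff_isSymm.mp hPd.1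
  have hZP : Z * Z⁻¹ = 1 :=
    Matrix.mul_nonsing_inv _ ((Matrix.isUnit_iff_isUnit_det _).mp hZ.isUnit)
  refine ⟨contDiff_quadratic _, ⟨by simp, fun x => ?_⟩, ?_⟩
  · have := hPd.posSemidef.dotProduct_mulVec_nonneg x
    rw [star_trivial] at this
    positivity
  simp_rw [fderiv_quadratic hPs]
  by_cases hD : D = 0
  · obtain ⟨h0, hB⟩ := h.2 hD
    obtain ⟨h1, h2⟩ := (negS_N0_iff hZs hPs hZP).mp h0
    have hB' := (mul_eq_transpose_iff hZs hZP).mp hB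
    have hv : ∀ x v, x ⬝ᵥ (Z⁻¹ *ᵥ (Bd *ᵥ v)) = v ⬝ᵥ (C *ᵥ x) := by
      intro x v
      rw [Matrix.mulVec_mulVec, hB', Matrix.dotProduct_mulVec, Matrix.vecMul_transpose,
        dotProduct_comm]
    cases mode with
    | nonstrict =>
      refine ⟨fun _ => 0, fun _ => rfl, fun x v => ?_⟩
      rw [Matrix.mulVec_add, dotProduct_add, hv, hD, Matrix.zero_mulVec, add_zero]
      linarith [h1 x]
    | strict =>
      refine ⟨fun x => -(x ⬝ᵥ (Z⁻¹ *ᵥ (closedLoop A Bu K *ᵥ x))),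
        ⟨by simp, fun x hx => neg_pos.mpr (h2 rfl x hx)⟩, fun x v => ?_⟩
      rw [Matrix.mulVec_add, dotProduct_add, hv, hD, Matrix.zero_mulVec, add_zero]
      linarith
  · obtain ⟨h1, h2⟩ := (negS_ND_iff hZs hPs hZP).mp (h.1 hD)
    cases mode with
    | nonstrict => exact ⟨fun _ => 0, fun _ => rfl, fun x v => by simpa using h1 x v⟩
    | strict =>
      -- the gap is a positive definite form in `(x, v)`, hence at least `c (|x|² + |v|²)`
      obtain ⟨c, hc, hcg⟩ := exists_mul_dotProduct_self_le
        (g := fun e : Fin n ⊕ Fin p → ℝ =>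
          (e ∘ Sum.inr) ⬝ᵥ (C *ᵥ (e ∘ Sum.inl) + D *ᵥ (e ∘ Sum.inr)) -
            (e ∘ Sum.inl) ⬝ᵥ (Z⁻¹ *ᵥ (closedLoop A Bu K *ᵥ (e ∘ Sum.inl) + Bd *ᵥ (e ∘ Sum.inr))))
        (by
          have hl : Continuous fun e : Fin n ⊕ Fin p → ℝ => e ∘ Sum.inl := by fun_prop
          have hr : Continuous fun e : Fin n ⊕ Fin p → ℝ => e ∘ Sum.inr := by fun_prop
          fun_prop)
        (fun r e => by
          have hl : (r • e) ∘ (Sum.inl : Fin n → Fin n ⊕ Fin p) = r • (e ∘ Sum.inl) := rfl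
          have hr : (r • e) ∘ (Sum.inr : Fin p → Fin n ⊕ Fin p) = r • (e ∘ Sum.inr) := rfl
          simp only [hl, hr, Matrix.mulVec_smul, ← smul_add, smul_dotProduct, dotProduct_smul,
            smul_eq_mul]
          ring)
        (fun e he => by
          refine sub_pos.mpr (h2 rfl _ _ ?_)
          by_contra! h0
          refine he ?_
          rw [← Sum.elim_comp_inl_inr e, h0.1, h0.2]
          ext i
          cases i <;> rfl)
      refine ⟨fun x => c * (x ⬝ᵥ x), ⟨by simp, fun x hx => mul_pos hc (dotProduct_self_pos hx)⟩,
        fun x v => ?_⟩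
      have h3 := hcg (Sum.elim x v)
      simp only [Sum.elim_comp_inl, Sum.elim_comp_inr, sumElim_dotProduct_sumElim] at h3
      have h4 : 0 ≤ v ⬝ᵥ v := Finset.sum_nonneg fun i _ => mul_self_nonneg (v i)
      nlinarith [mul_nonneg hc.le h4]

end LMI

/-! ### Feedback passivation -/

/-- Passivity produces a positive definite solution of the matrix inequality. -/
theorem IsPassive.exists_satisfiesLMI {n m p : ℕ} {mode : PassivityMode}
    {A : Matrix (Fin n) (Fin n) ℝ} {Bu : Matrix (Fin n) (Fin m) ℝ}
    {Bd : Matrix (Fin n) (Fin p) ℝ} {C : Matrix (Fin p) (Fin n) ℝ}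
    {D : Matrix (Fin p) (Fin p) ℝ} {K : Matrix (Fin m) (Fin n) ℝ}
    (hcon : IsControllable (closedLoop A Bu K) Bd) (hobs : IsObservable (closedLoop A Bu K) C)
    (hdet : mode = .strict → D ≠ 0 → (D + Dᵀ).det ≠ 0)
    (h : IsPassive mode (closedLoop A Bu K) Bd C D) :
    ∃ Z : Matrix (Fin n) (Fin n) ℝ, Z.PosDef ∧ SatisfiesLMI mode A Bu Bd C D Z (K * Z) := by
  obtain ⟨S, hS, ⟨hS00, hS0⟩, ψ, hψ, hSψ⟩ := h
  have hSd : ∀ x v, fderiv ℝ S x (closedLoop A Bu K *ᵥ x + Bd *ᵥ v) ≤ v ⬝ᵥ (C *ᵥ x + D *ᵥ v) :=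
    fun x v => (hSψ x v).trans (sub_le_self _ (hψ.nonneg x))
  obtain ⟨P₀, hP₀, hP₀d⟩ := hcon.exists_quadratic_of_dissipation hS hSd
  -- any symmetric solution of the dissipation inequalities will do
  suffices hex : ∃ P : Matrix (Fin n) (Fin n) ℝ, P.IsSymm ∧
      (∀ x v, x ⬝ᵥ (P *ᵥ (closedLoop A Bu K *ᵥ x + Bd *ᵥ v)) ≤ v ⬝ᵥ (C *ᵥ x + D *ᵥ v)) ∧
      (mode = .strict → (D ≠ 0 → ∀ x v, (x ≠ 0 ∨ v ≠ 0) →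
        x ⬝ᵥ (P *ᵥ (closedLoop A Bu K *ᵥ x + Bd *ᵥ v)) < v ⬝ᵥ (C *ᵥ x + D *ᵥ v)) ∧
        (D = 0 → ∀ x, x ≠ 0 → x ⬝ᵥ (P *ᵥ (closedLoop A Bu K *ᵥ x)) < 0)) ∧
      (D = 0 → P * Bd = Cᵀ) by
    obtain ⟨P, hPs, hPd, hPstrict, hPB⟩ := hex
    have hP : P.PosDef := hobs.posDef_of_dissipation hS hS0 hSd hPs hPd
    have hPZ : P⁻¹ * P = 1 :=
      Matrix.nonsing_inv_mul _ ((Matrix.isUnit_iff_isUnit_det _).mp hP.isUnit)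
    have hZs : (P⁻¹).IsSymm := Matrix.isHermitian_iff_isSymm.mp hP.inv.1
    refine ⟨P⁻¹, hP.inv, fun hD => ?_, fun hD => ⟨?_, ?_⟩⟩
    · exact (negS_ND_iff hZs hPs hPZ).mpr ⟨hPd, fun hm => (hPstrict hm).1 hD⟩
    · exact (negS_N0_iff hZs hPs hPZ).mpr
        ⟨fun x => by simpa using hPd x 0, fun hm => (hPstrict hm).2 hD⟩
    · exact (mul_eq_transpose_iff hZs hPZ).mpr (hPB hD)
  have hPB : ∀ P : Matrix (Fin n) (Fin n) ℝ,
      (∀ x v, x ⬝ᵥ (P *ᵥ (closedLoop A Bu K *ᵥ x + Bd *ᵥ v)) ≤ v ⬝ᵥ (C *ᵥ x + D *ᵥ v)) →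
      P.IsSymm → D = 0 → P * Bd = Cᵀ := by
    -- without feedthrough the inequality is affine in `v`
    intro P hPd hPs hD
    rw [← Matrix.mulVec_injective.eq_iff]
    funext v
    rw [← sub_eq_zero]
    refine dotProduct_eq_zero _ fun x => ?_
    rw [dotProduct_comm]
    refine slope_eq_zero (b := x ⬝ᵥ (P *ᵥ (closedLoop A Bu K *ᵥ x))) fun t => ?_
    have h1 := hPd x (t • v)
    rw [hD, Matrix.zero_mulVec, add_zero] at h1
    have h2 : x ⬝ᵥ (Cᵀ *ᵥ v) = v ⬝ᵥ (C *ᵥ x) := by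
      rw [Matrix.dotProduct_mulVec, Matrix.vecMul_transpose, dotProduct_comm]
    simp only [Matrix.mulVec_add, Matrix.mulVec_smul, dotProduct_add, dotProduct_smul,
      smul_dotProduct, smul_eq_mul, dotProduct_sub, h2, ← Matrix.mulVec_mulVec] at h1 ⊢
    linarith
  cases mode with
  | nonstrict => exact ⟨P₀, hP₀, hP₀d, by simp, hPB P₀ hP₀d hP₀⟩
  | strict =>
    by_cases hD : D = 0
    · have hP₀pd : P₀.PosDef := hobs.posDef_of_dissipation hS hS0 hSd hP₀ hP₀d
      have hSB : ∀ x v, fderiv ℝ S x (Bd *ᵥ v) = v ⬝ᵥ (C *ᵥ x) := by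
        intro x v
        rw [← sub_eq_zero]
        refine slope_eq_zero (b := fderiv ℝ S x (closedLoop A Bu K *ᵥ x)) fun t => ?_
        have h1 := hSd x (t • v)
        rw [hD, Matrix.zero_mulVec, add_zero, map_add, Matrix.mulVec_smul, map_smul,
          smul_dotProduct, smul_eq_mul, smul_eq_mul] at h1
        linarith
      obtain ⟨P, hP, hPBd, hPA⟩ := exists_quadratic_of_strict_of_no_feedthrough hP₀pd
        (hPB P₀ hP₀d hP₀ hD) hS hSB (A := closedLoop A Bu K) (fun x hx => by
          have h1 := hSψ x 0
          have h2 := hψ.2 x hx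
          simp only [Matrix.mulVec_zero, add_zero, zero_dotProduct] at h1
          linarith)
      refine ⟨P, hP, fun x v => ?_, fun _ => ⟨fun h0 => absurd hD h0, fun _ => hPA⟩, fun _ => hPBd⟩
      have h1 : x ⬝ᵥ (P *ᵥ (closedLoop A Bu K *ᵥ x)) ≤ 0 := by
        by_cases hx : x = 0
        · simp [hx]
        · exact (hPA x hx).le
      rw [Matrix.mulVec_add, dotProduct_add, Matrix.mulVec_mulVec v, hPBd,
        Matrix.dotProduct_mulVec x Cᵀ, Matrix.vecMul_transpose, dotProduct_comm _ v, hD,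
        Matrix.zero_mulVec, add_zero]
      linarith
    · -- the feedthrough is positive definite, so that the inequality is strict in `v` too
      have hD0 : ∀ v, 0 ≤ v ⬝ᵥ (D *ᵥ v) := fun v => by simpa using hP₀d 0 v
      have hDt : ∀ v, v ⬝ᵥ (Dᵀ *ᵥ v) = v ⬝ᵥ (D *ᵥ v) := fun v => by
        rw [Matrix.mulVec_transpose, dotProduct_comm, ← Matrix.dotProduct_mulVec]
      have hDsemi : (D + Dᵀ).PosSemidef := by
        refine Matrix.PosSemidef.of_dotProduct_mulVec_nonneg
          (Matrix.isHermitian_iff_isSymm.mpr (by simp [Matrix.IsSymm, add_comm])) fun v => ?_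
        rw [star_trivial, Matrix.add_mulVec, dotProduct_add, hDt]
        linarith [hD0 v]
      have hDpos : ∀ v, v ≠ 0 → 0 < v ⬝ᵥ (D *ᵥ v) := by
        intro v hv
        refine (hD0 v).lt_of_ne fun h0 => hv ?_
        have h1 : (D + Dᵀ) *ᵥ v = 0 := by
          rw [← hDsemi.dotProduct_mulVec_zero_iff, star_trivial, Matrix.add_mulVec, dotProduct_add,
            hDt, ← h0, add_zero]
        exact Matrix.eq_zero_of_mulVec_eq_zero (hdet rfl hD) h1
      have hgrad : fderiv ℝ S 0 = 0 := by
        refine IsLocalMin.fderiv_eq_zero (Filter.Eventually.of_forall fun x => ?_)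
        rw [hS00]
        exact hS0 x
      obtain ⟨P, hP, hPd⟩ := exists_quadratic_of_strict_dissipation_sum (A := closedLoop A Bu K)
        (B := Bd) (C := C) (D := D) hS 0 (fun x v hxv => by
          by_cases hx : x = 0
          · subst hx
            simpa [hgrad] using hDpos v (hxv.resolve_left fun h0 => h0 rfl)
          · linarith [hSψ x v, hψ.2 x hx])
      simp only [zero_mul, add_zero] at hPd
      refine ⟨P, hP, fun x v => ?_, fun _ => ⟨fun _ => hPd, fun h0 => absurd h0 hD⟩,
        fun h0 => absurd h0 hD⟩
      by_cases hxv : x ≠ 0 ∨ v ≠ 0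
      · exact (hPd x v hxv).le
      · push Not at hxv
        simp [hxv.1, hxv.2]

theorem mainTheorem6 {n m p : ℕ} (mode : PassivityMode)
    (A : Matrix (Fin n) (Fin n) ℝ) (Bu : Matrix (Fin n) (Fin m) ℝ)
    (Bd : Matrix (Fin n) (Fin p) ℝ) (C : Matrix (Fin p) (Fin n) ℝ)
    (D : Matrix (Fin p) (Fin p) ℝ) :
    (∀ K : Matrix (Fin m) (Fin n) ℝ,
      IsControllable (closedLoop A Bu K) Bd → IsObservable (closedLoop A Bu K) C →
      (mode = .strict → D ≠ 0 → (D + Dᵀ).det ≠ 0) →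
      (IsPassive mode (closedLoop A Bu K) Bd C D ↔
        ∃ (Z : Matrix (Fin n) (Fin n) ℝ) (W : Matrix (Fin m) (Fin n) ℝ),
          Z.PosDef ∧ SatisfiesLMI mode A Bu Bd C D Z W ∧ K = W * Z⁻¹)) ∧
    (∀ (Z : Matrix (Fin n) (Fin n) ℝ) (W : Matrix (Fin m) (Fin n) ℝ),
      Z.PosDef → SatisfiesLMI mode A Bu Bd C D Z W →
        IsStorageFunction mode (closedLoop A Bu (W * Z⁻¹)) Bd C D
          (fun x => (1 / 2 : ℝ) * (x ⬝ᵥ (Z⁻¹ *ᵥ x)))) := by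
  have hdet : ∀ {Z : Matrix (Fin n) (Fin n) ℝ}, Z.PosDef → IsUnit Z.det := fun hZ =>
    (Matrix.isUnit_iff_isUnit_det _).mp hZ.isUnit
  have hsuff : ∀ (Z : Matrix (Fin n) (Fin n) ℝ) (W : Matrix (Fin m) (Fin n) ℝ),
      Z.PosDef → SatisfiesLMI mode A Bu Bd C D Z W →
        IsStorageFunction mode (closedLoop A Bu (W * Z⁻¹)) Bd C D
          (fun x => (1 / 2 : ℝ) * (x ⬝ᵥ (Z⁻¹ *ᵥ x))) := by
    intro Z W hZ h
    refine SatisfiesLMI.isStorageFunction hZ ?_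
    rwa [Matrix.nonsing_inv_mul_cancel_right _ _ (hdet hZ)]
  refine ⟨fun K hcon hobs hD => ⟨fun h => ?_, ?_⟩, hsuff⟩
  · obtain ⟨Z, hZ, hLMI⟩ := h.exists_satisfiesLMI hcon hobs hD
    exact ⟨Z, K * Z, hZ, hLMI, (Matrix.mul_nonsing_inv_cancel_right _ _ (hdet hZ)).symm⟩
  · rintro ⟨Z, W, hZ, hLMI, rfl⟩
    exact ⟨_, hsuff Z W hZ hLMI⟩
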